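/- **Theorem 3.18.** Let $\Bbbk$ be an algebraically closed field of characteristic $0$, let $n\ge 1$, and let $q\in\Bbbk$ satisfy $q^n=1$ and have multiplicative order $d\ge 2$. Let $\Bbbk\mathcal Z(q)$ be the bialgebra with basis the paths $p_i^l$ ($i\in\mathbb Z_n$, $l\ge 0$; $p_i^l$ is the path of length $l$ starting at $i$) of the cyclic quiver with vertices $\mathbb Z_n$ and one arrow $i\to i+1$ for each $i$, with $$p_i^l\cdot p_j^m=q^{im}\binom{l+m}{l}_q\,p_{i+j}^{l+m},\qquad \Delta(p_i^l)=\sum_{a+b=l}p_{i+b}^{a}\otimes p_i^{b},\qquad \varepsilon(p_i^l)=\delta_{l,0},$$ where $\binom{l+m}{l}_q$ is the Gaussian binomial evaluated at $q$. Let $\mathcal C_q$ be the category of finite dimensional right $\Bbbk\mathcal Z(q)$-comodules, with the tensor product $u\otimes v\mapsto u_0\otimes v_0\otimes u_1v_1$. For $i\in\mathbb Z_n$ and $l\ge 0$ let $V(i,l)$ be the comodule with basis $v_0,\dots,v_l$ and structure map $v_m\mapsto\sum_{j=m}^{l}v_j\otimes p_{i+m}^{j-m}$. Equalities below mean isomorphism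 in $\mathcal C_q$, and an empty direct sum is $0$. Every $V(i,l)$ is indecomposable. Let $e,m\ge 0$ and $0\le f,h\le d-1$ be integers with $ed+f\le md+h$, and put $\gamma=f+h-d+1$. (1) If $f\le h$ and $f+h<d-1$, then $$\begin{aligned}V(0,ed+f)\otimes V(0,md+h)={}&\bigoplus_{k=0}^{e-1}\Big[\bigoplus_{i=0}^{f}V(kd+i,(e+m-2k)d+f+h-2i)\oplus\bigoplus_{j=f+1}^{h}V(kd+j,(e+m-2k)d-1)\\&\oplus\bigoplus_{r=h+1}^{f+h+1}V(kd+r,(e+m-2k)d+h+f-2r)\oplus\bigoplus_{s=f+h+2}^{d-1}V(kd+s,(e+m-1-2k)d-1)\Big]\\&\oplus\bigoplus_{i=0}^{f}V(ed+i,(m-e)d+h+f-2i).\end{aligned}$$ (2) If $0<f\le h$ and $f+h\ge d$, then $$\begin{aligned}V(0,ed+f)\otimes V(0,md+h)={}&\bigoplus_{k=0}^{e-1}\Big[\bigoplus_{i=0}^{\gamma}V(kd+i,(e+m-2k)d+d-1)\oplus\bigoplus_{j=\gamma+1}^{f}V(kd+j,(e+m-2k)d+f+h-2j)\\&\oplus\bigoplus_{r=f+1}^{h}V(kd+r,(e+m-2k)d-1)\oplus\bigoplus_{s=h+1}^{d-1}V(kd+s,(e+m-2k)d+h+f-2s)\Big]\\&\oplus\bigoplus_{i=0}^{\gamma}V(ed+i,(m-e)d+d-1)\oplus\bigoplus_{i=\gamma+1}^{f}V(ed+i,(m-e)d+f+h-2i).\end{aligned}$$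 (3) If $h<f$ and $f+h<d-1$, then $$\begin{aligned}V(0,ed+f)\otimes V(0,md+h)={}&\bigoplus_{k=0}^{e-1}\Big[\bigoplus_{i=0}^{h}V(kd+i,(e+m-2k)d+h+f-2i)\oplus\bigoplus_{j=h+1}^{f}V(kd+j,(e+m-2k)d-1)\\&\oplus\bigoplus_{r=f+1}^{h+f+1}V(kd+r,(e+m-2k)d+h+f-2r)\oplus\bigoplus_{s=f+h+2}^{d-1}V(kd+s,(e+m-1-2k)d-1)\Big]\\&\oplus\bigoplus_{i=0}^{h}V(ed+i,(m-e)d+h+f-2i)\oplus\bigoplus_{i=h+1}^{f}V(ed+i,(m-e)d-1).\end{aligned}$$ (4) If $0<h<f$ and $f+h\ge d$, then $$\begin{aligned}V(0,ed+f)\otimes V(0,md+h)={}&\bigoplus_{k=0}^{e-1}\Big[\bigoplus_{i=0}^{\gamma}V(kd+i,(e+m-2k)d+d-1)\oplus\bigoplus_{j=\gamma+1}^{h}V(kd+j,(e+m-2k)d+f+h-2j)\\&\oplus\bigoplus_{r=h+1}^{f}V(kd+r,(e+m-2k)d-1)\oplus\bigoplus_{s=f+1}^{d-1}V(kd+s,(e+m-2k)d+h+f-2s)\Big]\\&\oplus\bigoplus_{i=0}^{\gamma}V(ed+i,(m-e)d+d-1)\oplus\bigoplus_{i=\gamma+1}^{h}V(ed+i,(m-e)d+f+h-2i)\\&\oplus\bigoplus_{i=h+1}^{f}V(ed+i,(m-e)d-1).\end{aligned}$$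 -/

import Mathlib

open scoped TensorProduct DirectSum
open Finset (range Icc)
open Finset.HasAntidiagonal (antidiagonal)

universe u

/-! ## Gaussian binomials -/

section Gauss

variable {R : Type*} [CommRing R]

/-- `qBinom q l m` is the Gaussian binomial "`l + m` choose `l`" at `q`, as the value at `q` of
the usual polynomial, given by the `q`-Pascal rule. -/
def qBinom (q : R) : ℕ → ℕ → R
  | 0, _ => 1
  | _ + 1, 0 => 1
  | l + 1, m + 1 => qBinom q l (m + 1) + q ^ (l + 1) * qBinom q (l + 1) m

/-- `qNum q l = 1 + q + ⋯ + q ^ (l - 1)`. -/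
def qNum (q : R) (l : ℕ) : R := ∑ i ∈ range l, q ^ i

/-- `qFact q l = 1_q 2_q ⋯ l_q`. -/
def qFact (q : R) (l : ℕ) : R := ∏ i ∈ range l, qNum q (i + 1)

theorem qBinom_zero_left (q : R) (m : ℕ) : qBinom q 0 m = 1 := by
  rw [qBinom]

theorem qBinom_zero_right (q : R) (l : ℕ) : qBinom q l 0 = 1 := by
  cases l <;> rw [qBinom]

theorem qBinom_succ (q : R) (l m : ℕ) : qBinom q (l + 1) (m + 1) =
    qBinom q l (m + 1) + q ^ (l + 1) * qBinom q (l + 1) m := by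
  rw [qBinom]

/-- The quotient formula for Gaussian binomials, with denominators cleared (applied in `ℤ[X]` to
`q = X`, it determines them). -/
theorem qFact_mul_qFact_mul_qBinom (q : R) (l m : ℕ) :
    qFact q l * qFact q m * qBinom q l m = qFact q (l + m) := by
  induction l generalizing m with
  | zero => simp [qFact, qBinom_zero_left]
  | succ l ihl =>
    induction m with
    | zero => simp [qFact, qBinom_zero_right]
    | succ m ihm =>
      have h (n : ℕ) : qFact q (n + 1) = qFact q n * qNum q (n + 1) := by
        simp [qFact, Finset.prod_range_succ]
      have h2 : qNum q (l + 1 + (m + 1)) = qNum q (l + 1) + q ^ (l + 1) * qNum q (m + 1) := by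
        rw [qNum, qNum, qNum, Finset.sum_range_add, Finset.mul_sum]
        simp only [pow_add]
      have e1 := ihl (m + 1)
      have e2 : qFact q (l + 1 + (m + 1)) = qFact q (l + 1 + m) * qNum q (l + 1 + (m + 1)) :=
        h (l + 1 + m)
      rw [e2, h2, qBinom_succ]
      rw [show l + (m + 1) = l + 1 + m by ring] at e1
      rw [h l] at ihm ⊢
      rw [h m] at e1 ⊢
      linear_combination qNum q (l + 1) * e1 + q ^ (l + 1) * qNum q (m + 1) * ihm

theorem qBinom_assoc (q : R) (l m r : ℕ) :
    qBinom q l m * qBinom q (l + m) r = qBinom q m r * qBinom q l (m + r) := by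
  induction l generalizing m r with
  | zero => simp [qBinom_zero_left]
  | succ l ihl =>
    induction m generalizing r with
    | zero => simp [qBinom_zero_right, qBinom_zero_left]
    | succ m ihm =>
      induction r with
      | zero => simp [qBinom_zero_right]
      | succ r ihr =>
        have e1 := ihl (m + 1) (r + 1)
        have e2 := ihm (r + 1)
        have a1 : qBinom q (l + 1 + (m + 1)) (r + 1) = qBinom q (l + (m + 1)) (r + 1) +
            q ^ (l + 1 + (m + 1)) * qBinom q (l + 1 + (m + 1)) r := by
          rw [show l + 1 + (m + 1) = (l + (m + 1)) + 1 by ring, qBinom_succ]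
        have a2 : qBinom q (l + 1) (m + 1 + (r + 1)) = qBinom q l (m + 1 + (r + 1)) +
            q ^ (l + 1) * qBinom q (l + 1) (m + (r + 1)) := by
          rw [show m + 1 + (r + 1) = (m + (r + 1)) + 1 by ring, qBinom_succ]
        have a3 := qBinom_succ q l m
        have a4 := qBinom_succ q m r
        rw [show l + 1 + m = l + (m + 1) by ring] at e2
        rw [show m + 1 + r = m + (r + 1) by ring] at ihr
        linear_combination qBinom q (l + 1) (m + 1) * a1 - qBinom q (m + 1) (r + 1) * a2 +
          q ^ (l + 1 + (m + 1)) * ihr + e1 + q ^ (l + 1) * e2 +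
          qBinom q (l + (m + 1)) (r + 1) * a3 -
          q ^ (l + 1) * qBinom q (l + 1) (m + (r + 1)) * a4

/-- The `q`-Vandermonde identity, in the form in which it gives the multiplicativity of the
comultiplication of the path coalgebra. -/
theorem qBinom_vandermonde {M : Type*} [AddCommGroup M] [Module R M] (q : R) (l m : ℕ)
    (F : ℕ → ℕ → M) :
    ∑ x ∈ antidiagonal l, ∑ y ∈ antidiagonal m,
      (q ^ (x.2 * y.1) * qBinom q x.1 y.1 * qBinom q x.2 y.2) • F (x.1 + y.1) (x.2 + y.2) =
    qBinom q l m • ∑ z ∈ antidiagonal (l + m), F z.1 z.2 := by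
  induction l generalizing m F with
  | zero => simp [qBinom_zero_left]
  | succ l ihl =>
    induction m generalizing F with
    | zero => simp [qBinom_zero_right]
    | succ m ihm =>
      have e1 := ihl (m + 1) (fun a b => F (a + 1) b)
      have e2 := ihm (fun a b => F (a + 1) b)
      have e0 : ∑ z ∈ antidiagonal (l + 1 + (m + 1)), F z.1 z.2 = F 0 (l + (m + 1) + 1) +
          ∑ z ∈ antidiagonal (l + (m + 1)), F (z.1 + 1) z.2 := by
        rw [show l + 1 + (m + 1) = (l + (m + 1)) + 1 by ring, Finset.Nat.sum_antidiagonal_succ]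
      rw [e0]
      rw [show l + 1 + m = l + (m + 1) by ring] at e2
      have key : qBinom q (l + 1) (m + 1) • ∑ z ∈ antidiagonal (l + (m + 1)), F (z.1 + 1) z.2 =
          qBinom q l (m + 1) • ∑ z ∈ antidiagonal (l + (m + 1)), F (z.1 + 1) z.2 +
          q ^ (l + 1) • (qBinom q (l + 1) m •
            ∑ z ∈ antidiagonal (l + (m + 1)), F (z.1 + 1) z.2) := by
        rw [qBinom_succ, add_smul, mul_smul]
      rw [smul_add, key, ← e1, ← e2]
      have hl' (f : ℕ × ℕ → M) : ∑ x ∈ antidiagonal (l + 1), f x =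
          f (0, l + 1) + ∑ x ∈ antidiagonal l, f (x.1 + 1, x.2) :=
        Finset.Nat.sum_antidiagonal_succ
      have hm' (f : ℕ × ℕ → M) : ∑ x ∈ antidiagonal (m + 1), f x =
          f (0, m + 1) + ∑ x ∈ antidiagonal m, f (x.1 + 1, x.2) :=
        Finset.Nat.sum_antidiagonal_succ
      simp only [hl', hm', Finset.smul_sum, Finset.sum_add_distrib, smul_add]
      have h3 : ∑ x ∈ antidiagonal l, ∑ y ∈ antidiagonal m,
          (q ^ (x.2 * (y.1 + 1)) * qBinom q (x.1 + 1) (y.1 + 1) * qBinom q x.2 y.2) •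
            F (x.1 + 1 + (y.1 + 1)) (x.2 + y.2) =
          ∑ x ∈ antidiagonal l, ∑ y ∈ antidiagonal m,
          (q ^ (x.2 * (y.1 + 1)) * qBinom q x.1 (y.1 + 1) * qBinom q x.2 y.2) •
            F (x.1 + (y.1 + 1) + 1) (x.2 + y.2) +
          ∑ x ∈ antidiagonal l, ∑ y ∈ antidiagonal m,
          q ^ (l + 1) • (q ^ (x.2 * y.1) * qBinom q (x.1 + 1) y.1 * qBinom q x.2 y.2) •
            F (x.1 + 1 + y.1 + 1) (x.2 + y.2) := by
        rw [← Finset.sum_add_distrib]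
        refine Finset.sum_congr rfl fun x hx => ?_
        rw [← Finset.sum_add_distrib]
        refine Finset.sum_congr rfl fun y hy => ?_
        have hx' : x.1 + x.2 = l := by simpa using hx
        rw [show x.1 + (y.1 + 1) + 1 = x.1 + 1 + (y.1 + 1) by ring,
          show x.1 + 1 + y.1 + 1 = x.1 + 1 + (y.1 + 1) by ring, smul_smul, ← add_smul,
          qBinom_succ, ← hx']
        congr 1
        ring
      rw [h3]
      simp only [qBinom_zero_left, qBinom_zero_right, pow_zero, one_mul, mul_one, mul_zero,
        zero_add, add_zero, smul_smul]
      have h4 : ∑ x ∈ antidiagonal m,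
          (q ^ ((l + 1) * (x.1 + 1)) * qBinom q (l + 1) x.2) • F (x.1 + 1) (l + 1 + x.2) =
          ∑ x ∈ antidiagonal m,
          (q ^ (l + 1) * (q ^ ((l + 1) * x.1) * qBinom q (l + 1) x.2)) •
            F (x.1 + 1) (l + 1 + x.2) := by
        refine Finset.sum_congr rfl fun x _ => ?_
        congr 1
        ring
      rw [h4, show l + (m + 1) + 1 = l + 1 + (m + 1) by ring]
      abel

theorem sum_antidiagonal_assoc {M : Type*} [AddCommMonoid M] (l : ℕ) (F : ℕ → ℕ → ℕ → M) :
    ∑ x ∈ antidiagonal l, ∑ y ∈ antidiagonal x.1, F y.1 y.2 x.2 =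
    ∑ x ∈ antidiagonal l, ∑ y ∈ antidiagonal x.2, F x.1 y.1 y.2 := by
  induction l generalizing F with
  | zero => simp
  | succ l ih =>
    have e := ih (fun a b c => F (a + 1) b c)
    simp only [Finset.Nat.sum_antidiagonal_succ, Finset.sum_add_distrib]
    rw [e]
    simp [add_assoc]

end Gauss

/-! ## The Hopf path algebra of the cyclic quiver -/

noncomputable section

/-- The space spanned by the paths of the cyclic quiver with vertex set `ZMod n` and one arrow
`i ⟶ i + 1` for each `i`. The basis vector indexed by `(i, l)` is the path of length `l` that
starts at `i`. The parameter `q`, an `n`-th root of unity, enters the multiplication below. -/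
def CyclicPath {𝕜 : Type u} [Field 𝕜] {n : ℕ} (_q : rootsOfUnity n 𝕜) : Type u :=
  (ZMod n × ℕ) →₀ 𝕜

namespace CyclicPath

variable {𝕜 : Type u} [Field 𝕜] {n : ℕ} (q : rootsOfUnity n 𝕜)

instance : AddCommGroup (CyclicPath q) := inferInstanceAs (AddCommGroup ((ZMod n × ℕ) →₀ 𝕜))

instance : Module 𝕜 (CyclicPath q) := inferInstanceAs (Module 𝕜 ((ZMod n × ℕ) →₀ 𝕜))

/-- The root of unity as an element of the field. -/
abbrev root : 𝕜 := ((q : 𝕜ˣ) : 𝕜)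

/-- The path of length `l` that starts at `i`. -/
def path (i : ZMod n) (l : ℕ) : CyclicPath q := Finsupp.single (i, l) (1 : 𝕜)

/-- The linear map with prescribed values on paths. -/
def lift {M : Type*} [AddCommGroup M] [Module 𝕜 M] (f : ZMod n → ℕ → M) : CyclicPath q →ₗ[𝕜] M :=
  Finsupp.linearCombination 𝕜 (fun x : ZMod n × ℕ => f x.1 x.2)

variable {q} in
@[simp] theorem lift_path {M : Type*} [AddCommGroup M] [Module 𝕜 M] (f : ZMod n → ℕ → M)
    (i : ZMod n) (l : ℕ) : lift q f (path q i l) = f i l := by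
  refine (Finsupp.linearCombination_single 𝕜 (1 : 𝕜) (i, l)).trans ?_
  simp

variable {q} in
theorem hom_ext {M : Type*} [AddCommGroup M] [Module 𝕜 M] {f g : CyclicPath q →ₗ[𝕜] M}
    (h : ∀ i l, f (path q i l) = g (path q i l)) : f = g := by
  refine Finsupp.lhom_ext' (M := 𝕜) (N := M) fun x => LinearMap.ext_ring ?_
  exact h x.1 x.2

/-- `q ^ i` for `i : ZMod n`. -/
def qPow (i : ZMod n) : 𝕜 := root q ^ i.val

variable {q} in
theorem root_pow_mod (m : ℕ) : root q ^ (m % n) = root q ^ m := by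
  have h : root q ^ n = 1 := by
    have := (mem_rootsOfUnity n (q : 𝕜ˣ)).1 q.2
    rw [root, ← Units.val_pow_eq_pow_val, this, Units.val_one]
  conv_rhs => rw [← Nat.mod_add_div m n, pow_add, pow_mul, h, one_pow, mul_one]

@[simp] theorem qPow_zero : qPow q 0 = 1 := by
  simp [qPow]

theorem qPow_natCast (m : ℕ) : qPow q (m : ZMod n) = root q ^ m := by
  rw [qPow, ZMod.val_natCast, root_pow_mod]

theorem qPow_add [NeZero n] (i j : ZMod n) : qPow q (i + j) = qPow q i * qPow q j := by
  rw [qPow, qPow, qPow, ZMod.val_add, root_pow_mod, pow_add]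

/-- The multiplication of paths,
`p_i^l · p_j^m = q ^ (i m) * binom (l + m, l)_q • p_{i + j}^{l + m}`. -/
def mulMap : CyclicPath q →ₗ[𝕜] CyclicPath q →ₗ[𝕜] CyclicPath q :=
  lift q fun i l => lift q fun j m =>
    (qPow q i ^ m * qBinom (root q) l m) • path q (i + j) (l + m)

instance : Mul (CyclicPath q) := ⟨fun x y => mulMap q x y⟩

instance : One (CyclicPath q) := ⟨path q 0 0⟩

theorem mul_def (x y : CyclicPath q) : x * y = mulMap q x y := rfl

theorem one_def : (1 : CyclicPath q) = path q 0 0 := rfl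

theorem path_mul_path (i j : ZMod n) (l m : ℕ) : path q i l * path q j m =
    (qPow q i ^ m * qBinom (root q) l m) • path q (i + j) (l + m) := by
  simp [mul_def, mulMap]

instance : NonUnitalNonAssocRing (CyclicPath q) where
  left_distrib x y z := by simp [mul_def]
  right_distrib x y z := by simp [mul_def]
  zero_mul x := by simp [mul_def]
  mul_zero x := by simp [mul_def]

instance : IsScalarTower 𝕜 (CyclicPath q) (CyclicPath q) where
  smul_assoc a x y := by simp [mul_def]

instance : SMulCommClass 𝕜 (CyclicPath q) (CyclicPath q) where
  smul_comm a x y := by simp [mul_def]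

variable {q} in
theorem induction {p : CyclicPath q → Prop} (x : CyclicPath q) (h0 : p 0)
    (hadd : ∀ x y, p x → p y → p (x + y)) (hsmul : ∀ (a : 𝕜) i l, p (a • path q i l)) : p x := by
  refine Finsupp.induction_linear (motive := p) x h0 hadd fun a b => ?_
  have e : b • path q a.1 a.2 = (Finsupp.single a b : (ZMod n × ℕ) →₀ 𝕜) := by
    refine (Finsupp.smul_single b a (1 : 𝕜)).trans ?_
    simp
  have h := hsmul b a.1 a.2
  rw [e] at h
  exact h

variable [NeZero n]

instance : Ring (CyclicPath q) where
  one_mul x := by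
    induction x using induction with
    | h0 => simp
    | hadd x y hx hy => rw [mul_add, hx, hy]
    | hsmul a i l => simp [one_def, path_mul_path, qBinom_zero_left, mul_smul_comm]
  mul_one x := by
    induction x using induction with
    | h0 => simp
    | hadd x y hx hy => rw [add_mul, hx, hy]
    | hsmul a i l => simp [one_def, path_mul_path, qBinom_zero_right, smul_mul_assoc]
  mul_assoc x y z := by
    induction x using induction with
    | h0 => simp
    | hadd x y hx hy => simp only [add_mul, hx, hy]
    | hsmul a i l =>
    induction y using induction with
    | h0 => simp
    | hadd x y hx hy => simp only [add_mul, mul_add, hx, hy]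
    | hsmul b j m =>
    induction z using induction with
    | h0 => simp
    | hadd x y hx hy => simp only [mul_add, hx, hy]
    | hsmul c k r =>
    simp only [smul_mul_assoc, mul_smul_comm, path_mul_path, smul_smul, add_assoc, qPow_add,
      mul_pow, pow_add]
    congr 1
    linear_combination c * b * a * qPow q i ^ m * qPow q i ^ r * qPow q j ^ r *
      qBinom_assoc (root q) l m r
  neg_add_cancel := neg_add_cancel
  zsmul := (· • ·)
  zsmul_zero' := SubNegMonoid.zsmul_zero'
  zsmul_succ' := SubNegMonoid.zsmul_succ'
  zsmul_neg' := SubNegMonoid.zsmul_neg'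
  sub_eq_add_neg := sub_eq_add_neg

instance : Algebra 𝕜 (CyclicPath q) :=
  Algebra.ofModule (fun a x y => smul_mul_assoc a x y) (fun a x y => mul_smul_comm a x y)

/-- The path coalgebra: a path is sent to the sum of all its splittings
(final part) `⊗` (initial part), and the counit is `1` on vertices and `0` on longer paths. -/
instance : CoalgebraStruct 𝕜 (CyclicPath q) where
  comul := lift q fun i l => ∑ c ∈ antidiagonal l, path q (i + (c.2 : ZMod n)) c.1 ⊗ₜ path q i c.2
  counit := lift q fun _ l => if l = 0 then 1 else 0

theorem comul_path (i : ZMod n) (l : ℕ) : Coalgebra.comul (R := 𝕜) (path q i l) =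
    ∑ c ∈ antidiagonal l, path q (i + (c.2 : ZMod n)) c.1 ⊗ₜ[𝕜] path q i c.2 :=
  lift_path (fun i l => ∑ c ∈ antidiagonal l,
    path q (i + (c.2 : ZMod n)) c.1 ⊗ₜ[𝕜] path q i c.2) i l

theorem counit_path (i : ZMod n) (l : ℕ) : Coalgebra.counit (R := 𝕜) (path q i l) =
    (if l = 0 then 1 else 0 : 𝕜) :=
  lift_path (fun _ l => if l = 0 then (1 : 𝕜) else 0) i l

instance : Coalgebra 𝕜 (CyclicPath q) where
  coassoc := by
    refine hom_ext fun i l => ?_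
    simp only [LinearMap.comp_apply, comul_path, map_sum, LinearMap.rTensor_tmul,
      LinearMap.lTensor_tmul, TensorProduct.sum_tmul, TensorProduct.tmul_sum, LinearEquiv.coe_coe,
      TensorProduct.assoc_tmul]
    have := sum_antidiagonal_assoc l (fun a b c => path q (i + (c : ZMod n) + (b : ZMod n)) a ⊗ₜ[𝕜]
      (path q (i + (c : ZMod n)) b ⊗ₜ[𝕜] path q i c))
    rw [this]
    refine Finset.sum_congr rfl fun x _ => Finset.sum_congr rfl fun y hy => ?_
    have hy' : y.1 + y.2 = x.2 := by simpa using hy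
    rw [← hy', Nat.cast_add, add_assoc, add_comm (y.2 : ZMod n)]
  rTensor_counit_comp_comul := by
    refine hom_ext fun i l => ?_
    simp only [LinearMap.comp_apply, comul_path, map_sum, LinearMap.rTensor_tmul, counit_path]
    rw [Finset.sum_eq_single (0, l)]
    · simp
    · rintro ⟨a, b⟩ h1 h2
      have : a ≠ 0 := by
        rintro rfl
        simp at h1
        simp [h1] at h2
      simp [this]
    · simp
  lTensor_counit_comp_comul := by
    refine hom_ext fun i l => ?_
    simp only [LinearMap.comp_apply, comul_path, map_sum, LinearMap.lTensor_tmul, counit_path]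
    rw [Finset.sum_eq_single (l, 0)]
    · simp
    · rintro ⟨a, b⟩ h1 h2
      have : b ≠ 0 := by
        rintro rfl
        simp at h1
        simp [h1] at h2
      simp [this]
    · simp

/-- The path bialgebra of the cyclic quiver attached to the root of unity `q`. -/
instance : Bialgebra 𝕜 (CyclicPath q) := Bialgebra.mk' 𝕜 (CyclicPath q)
  (by simp [one_def, counit_path])
  (by
    intro x y
    induction x using induction with
    | h0 => simp
    | hadd x y hx hy => simp only [add_mul, hx, hy, map_add]
    | hsmul a i l =>
    induction y using induction with
    | h0 => simp
    | hadd x y hx hy => simp only [mul_add, hx, hy, map_add]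
    | hsmul b j m =>
    simp only [smul_mul_assoc, mul_smul_comm, path_mul_path, map_smul, counit_path]
    rcases l with _ | l <;> rcases m with _ | m <;> simp [qBinom_zero_left, mul_comm])
  (by simp [one_def, comul_path, Algebra.TensorProduct.one_def])
  (by
    intro x y
    induction x using induction with
    | h0 => simp
    | hadd x y hx hy => simp only [add_mul, hx, hy, map_add]
    | hsmul a i l =>
    induction y using induction with
    | h0 => simp
    | hadd x y hx hy => simp only [mul_add, hx, hy, map_add]
    | hsmul b j m =>
    simp only [smul_mul_assoc, mul_smul_comm, path_mul_path, map_smul, comul_path]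
    congr 2
    have := qBinom_vandermonde (root q) l m (fun a b =>
      path q (i + j + (b : ZMod n)) a ⊗ₜ[𝕜] path q (i + j) b)
    rw [mul_smul, ← this, Finset.sum_mul_sum, Finset.smul_sum]
    refine Finset.sum_congr rfl fun x _ => ?_
    rw [Finset.smul_sum]
    refine Finset.sum_congr rfl fun y hy => ?_
    have hy' : y.1 + y.2 = m := by simpa using hy
    rw [Algebra.TensorProduct.tmul_mul_tmul, path_mul_path, path_mul_path, qPow_add,
      qPow_natCast, TensorProduct.smul_tmul_smul, smul_smul, ← hy', Nat.cast_add,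
      show i + (x.2 : ZMod n) + (j + (y.2 : ZMod n)) = i + j + ((x.2 : ZMod n) + y.2) by ring]
    congr 1
    ring)

end CyclicPath

/-! ## Finite dimensional right comodules over a bialgebra -/

/-- Finite dimensional right comodules over a bialgebra `H`. -/
structure Comod (𝕜 : Type u) (H : Type u) [Field 𝕜] [Ring H] [Bialgebra 𝕜 H] where
  /-- the underlying space -/
  carrier : Type u
  [addCommGroup : AddCommGroup carrier]
  [module : Module 𝕜 carrier]
  [finite : Module.Finite 𝕜 carrier]
  /-- the structure map -/
  coact : carrier →ₗ[𝕜] carrier ⊗[𝕜] H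
  coassoc : TensorProduct.assoc 𝕜 carrier H H ∘ₗ coact.rTensor H ∘ₗ coact =
    (Coalgebra.comul (R := 𝕜) (A := H)).lTensor carrier ∘ₗ coact
  counit : (Coalgebra.counit (R := 𝕜) (A := H)).lTensor carrier ∘ₗ coact =
    (TensorProduct.mk 𝕜 carrier 𝕜).flip 1

namespace Comod

attribute [instance] Comod.addCommGroup Comod.module Comod.finite

variable {𝕜 : Type u} {H : Type u} [Field 𝕜] [Ring H] [Bialgebra 𝕜 H]

/-- Isomorphism of comodules: there is a linear bijection that commutes with the structure
maps. -/
def Iso (A B : Comod 𝕜 H) : Prop :=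
  ∃ e : A.carrier ≃ₗ[𝕜] B.carrier,
    (e : A.carrier →ₗ[𝕜] B.carrier).rTensor H ∘ₗ A.coact =
      B.coact ∘ₗ (e : A.carrier →ₗ[𝕜] B.carrier)

/-- For an algebra `T`, the map `(v ⊗ s) ⊗ (w ⊗ t) ↦ (v ⊗ w) ⊗ s t`. -/
def mulTensor (V W T : Type u) [AddCommGroup V] [Module 𝕜 V] [AddCommGroup W] [Module 𝕜 W]
    [Ring T] [Algebra 𝕜 T] : (V ⊗[𝕜] T) ⊗[𝕜] (W ⊗[𝕜] T) →ₗ[𝕜] (V ⊗[𝕜] W) ⊗[𝕜] T :=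
  (LinearMap.mul' 𝕜 T).lTensor (V ⊗[𝕜] W) ∘ₗ
    (TensorProduct.tensorTensorTensorComm 𝕜 V T W T).toLinearMap

@[simp] theorem mulTensor_tmul {V W T : Type u} [AddCommGroup V] [Module 𝕜 V] [AddCommGroup W]
    [Module 𝕜 W] [Ring T] [Algebra 𝕜 T] (v : V) (w : W) (s t : T) :
    mulTensor (𝕜 := 𝕜) V W T ((v ⊗ₜ s) ⊗ₜ (w ⊗ₜ t)) = (v ⊗ₜ w) ⊗ₜ (s * t) := by
  simp [mulTensor]

/-- The structure map `v ⊗ w ↦ v₀ ⊗ w₀ ⊗ v₁ w₁` of the tensor product. -/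
def tensorCoact (A B : Comod 𝕜 H) :
    A.carrier ⊗[𝕜] B.carrier →ₗ[𝕜] (A.carrier ⊗[𝕜] B.carrier) ⊗[𝕜] H :=
  mulTensor A.carrier B.carrier H ∘ₗ TensorProduct.map A.coact B.coact

theorem assoc_mulTensor {V W : Type u} [AddCommGroup V] [Module 𝕜 V] [AddCommGroup W]
    [Module 𝕜 W] (s : V ⊗[𝕜] H) (t : W ⊗[𝕜] H) (g h : H) :
    TensorProduct.assoc 𝕜 (V ⊗[𝕜] W) H H (mulTensor (𝕜 := 𝕜) V W H (s ⊗ₜ t) ⊗ₜ (g * h)) =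
    mulTensor (𝕜 := 𝕜) V W (H ⊗[𝕜] H) (TensorProduct.assoc 𝕜 V H H (s ⊗ₜ g) ⊗ₜ
      TensorProduct.assoc 𝕜 W H H (t ⊗ₜ h)) := by
  induction s with
  | zero => simp
  | add x y hx hy => simp only [TensorProduct.add_tmul, map_add, hx, hy]
  | tmul v a =>
    induction t with
    | zero => simp
    | add x y hx hy => simp only [TensorProduct.add_tmul, TensorProduct.tmul_add, map_add, hx, hy]
    | tmul w b => simp

theorem assoc_rTensor_tensorCoact (A B : Comod 𝕜 H) (x : A.carrier ⊗[𝕜] H)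
    (y : B.carrier ⊗[𝕜] H) :
    TensorProduct.assoc 𝕜 (A.carrier ⊗[𝕜] B.carrier) H H
      ((tensorCoact A B).rTensor H (mulTensor A.carrier B.carrier H (x ⊗ₜ y))) =
    mulTensor (𝕜 := 𝕜) A.carrier B.carrier (H ⊗[𝕜] H)
      (TensorProduct.assoc 𝕜 _ H H (A.coact.rTensor H x) ⊗ₜ
        TensorProduct.assoc 𝕜 _ H H (B.coact.rTensor H y)) := by
  induction x with
  | zero => simp
  | add x y hx hy => simp only [TensorProduct.add_tmul, map_add, hx, hy]
  | tmul v a =>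
    induction y with
    | zero => simp
    | add x y hx hy => simp only [TensorProduct.tmul_add, map_add, hx, hy]
    | tmul w b =>
      simp only [mulTensor_tmul, LinearMap.rTensor_tmul, tensorCoact, LinearMap.comp_apply,
        TensorProduct.map_tmul, assoc_mulTensor]

theorem lTensor_comul_mulTensor {V W : Type u} [AddCommGroup V] [Module 𝕜 V] [AddCommGroup W]
    [Module 𝕜 W] (x : V ⊗[𝕜] H) (y : W ⊗[𝕜] H) :
    (Coalgebra.comul (R := 𝕜) (A := H)).lTensor (V ⊗[𝕜] W) (mulTensor V W H (x ⊗ₜ y)) =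
    mulTensor (𝕜 := 𝕜) V W (H ⊗[𝕜] H)
      ((Coalgebra.comul (R := 𝕜) (A := H)).lTensor V x ⊗ₜ
        (Coalgebra.comul (R := 𝕜) (A := H)).lTensor W y) := by
  induction x with
  | zero => simp
  | add x y hx hy => simp only [TensorProduct.add_tmul, map_add, hx, hy]
  | tmul v a =>
    induction y with
    | zero => simp
    | add x y hx hy => simp only [TensorProduct.tmul_add, map_add, hx, hy]
    | tmul w b => simp

theorem lTensor_counit_mulTensor {V W : Type u} [AddCommGroup V] [Module 𝕜 V] [AddCommGroup W]
    [Module 𝕜 W] (x : V ⊗[𝕜] H) (y : W ⊗[𝕜] H) :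
    (Coalgebra.counit (R := 𝕜) (A := H)).lTensor (V ⊗[𝕜] W) (mulTensor V W H (x ⊗ₜ y)) =
    mulTensor (𝕜 := 𝕜) V W 𝕜
      ((Coalgebra.counit (R := 𝕜) (A := H)).lTensor V x ⊗ₜ
        (Coalgebra.counit (R := 𝕜) (A := H)).lTensor W y) := by
  induction x with
  | zero => simp
  | add x y hx hy => simp only [TensorProduct.add_tmul, map_add, hx, hy]
  | tmul v a =>
    induction y with
    | zero => simp
    | add x y hx hy => simp only [TensorProduct.tmul_add, map_add, hx, hy]
    | tmul w b => simp

/-- The tensor product of comodules over a bialgebra. -/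
def tensor (A B : Comod 𝕜 H) : Comod 𝕜 H where
  carrier := A.carrier ⊗[𝕜] B.carrier
  coact := tensorCoact A B
  coassoc := by
    refine TensorProduct.ext' fun v w => ?_
    have hA := LinearMap.congr_fun A.coassoc v
    have hB := LinearMap.congr_fun B.coassoc w
    simp only [LinearMap.comp_apply, LinearEquiv.coe_coe] at hA hB
    have e : tensorCoact A B (v ⊗ₜ w) = mulTensor A.carrier B.carrier H
        (A.coact v ⊗ₜ B.coact w) := by simp [tensorCoact]
    simp only [LinearMap.comp_apply, LinearEquiv.coe_coe]
    rw [e, assoc_rTensor_tensorCoact, hA, hB, lTensor_comul_mulTensor]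
  counit := by
    refine TensorProduct.ext' fun v w => ?_
    have hA := LinearMap.congr_fun A.counit v
    have hB := LinearMap.congr_fun B.counit w
    simp only [LinearMap.comp_apply] at hA hB
    simp only [LinearMap.comp_apply, tensorCoact, TensorProduct.map_tmul,
      lTensor_counit_mulTensor]
    rw [hA, hB]
    simp

theorem assoc_rTensor_rTensor {V W : Type u} [AddCommGroup V] [Module 𝕜 V] [AddCommGroup W]
    [Module 𝕜 W] (f : V →ₗ[𝕜] W) (x : (V ⊗[𝕜] H) ⊗[𝕜] H) :
    TensorProduct.assoc 𝕜 W H H ((f.rTensor H).rTensor H x) =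
      f.rTensor (H ⊗[𝕜] H) (TensorProduct.assoc 𝕜 V H H x) := by
  rw [LinearMap.rTensor_tensor]
  simp

theorem rTensor_lTensor {V W T T' : Type u} [AddCommGroup V] [Module 𝕜 V] [AddCommGroup W]
    [Module 𝕜 W] [AddCommGroup T] [Module 𝕜 T] [AddCommGroup T'] [Module 𝕜 T'] (f : V →ₗ[𝕜] W)
    (g : T →ₗ[𝕜] T') (x : V ⊗[𝕜] T) :
    f.rTensor T' (g.lTensor V x) = g.lTensor W (f.rTensor T x) := by
  induction x with
  | zero => simp
  | add x y hx hy => simp only [map_add, hx, hy]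
  | tmul v a => simp

/-- The direct sum of two comodules. -/
def prod (A B : Comod 𝕜 H) : Comod 𝕜 H where
  carrier := A.carrier × B.carrier
  coact := LinearMap.coprod
    ((LinearMap.inl 𝕜 A.carrier B.carrier).rTensor H ∘ₗ A.coact)
    ((LinearMap.inr 𝕜 A.carrier B.carrier).rTensor H ∘ₗ B.coact)
  coassoc := by
    refine LinearMap.prod_ext (LinearMap.ext fun v => ?_) (LinearMap.ext fun v => ?_)
    · have hA := LinearMap.congr_fun A.coassoc v
      simp only [LinearMap.comp_apply, LinearEquiv.coe_coe] at hA
      simp only [LinearMap.comp_apply, LinearEquiv.coe_coe,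
        LinearMap.coprod_apply, LinearMap.inl_apply, map_zero, add_zero]
      rw [← LinearMap.rTensor_comp_apply, LinearMap.coprod_inl, LinearMap.rTensor_comp_apply,
        assoc_rTensor_rTensor, hA, rTensor_lTensor]
    · have hA := LinearMap.congr_fun B.coassoc v
      simp only [LinearMap.comp_apply, LinearEquiv.coe_coe] at hA
      simp only [LinearMap.comp_apply, LinearEquiv.coe_coe,
        LinearMap.coprod_apply, LinearMap.inr_apply, map_zero, zero_add]
      rw [← LinearMap.rTensor_comp_apply, LinearMap.coprod_inr, LinearMap.rTensor_comp_apply,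
        assoc_rTensor_rTensor, hA, rTensor_lTensor]
  counit := by
    refine LinearMap.prod_ext (LinearMap.ext fun v => ?_) (LinearMap.ext fun v => ?_)
    · have hA := LinearMap.congr_fun A.counit v
      simp only [LinearMap.comp_apply] at hA
      simp only [LinearMap.comp_apply,
        LinearMap.coprod_apply, LinearMap.inl_apply, map_zero, add_zero]
      rw [← rTensor_lTensor, hA]
      simp
    · have hA := LinearMap.congr_fun B.counit v
      simp only [LinearMap.comp_apply] at hA
      simp only [LinearMap.comp_apply,
        LinearMap.coprod_apply, LinearMap.inr_apply, map_zero, zero_add]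
      rw [← rTensor_lTensor, hA]
      simp

/-- The direct sum of the comodules `F j`, for `j` in a finite set `s`. -/
def sum (s : Finset ℕ) (F : ℕ → Comod 𝕜 H) : Comod 𝕜 H where
  carrier := ⨁ j : s, (F j).carrier
  coact := DirectSum.toModule 𝕜 s ((⨁ j : s, (F j).carrier) ⊗[𝕜] H) fun j =>
    (DirectSum.lof 𝕜 s (fun j : s => (F j).carrier) j).rTensor H ∘ₗ (F j).coact
  coassoc := by
    refine DirectSum.linearMap_ext _ fun j => LinearMap.ext fun v => ?_
    have hA := LinearMap.congr_fun (F j).coassoc v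
    simp only [LinearMap.comp_apply, LinearEquiv.coe_coe] at hA
    simp only [LinearMap.comp_apply, LinearEquiv.coe_coe, DirectSum.toModule_lof]
    rw [← LinearMap.rTensor_comp_apply]
    have e : (DirectSum.toModule 𝕜 s ((⨁ j : s, (F j).carrier) ⊗[𝕜] H) fun j =>
        (DirectSum.lof 𝕜 s (fun j : s => (F j).carrier) j).rTensor H ∘ₗ (F j).coact) ∘ₗ
        DirectSum.lof 𝕜 s (fun j : s => (F j).carrier) j =
        (DirectSum.lof 𝕜 s (fun j : s => (F j).carrier) j).rTensor H ∘ₗ (F j).coact :=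
      LinearMap.ext fun v => DirectSum.toModule_lof _ _ _
    rw [e, LinearMap.rTensor_comp_apply, assoc_rTensor_rTensor, hA, rTensor_lTensor]
  counit := by
    refine DirectSum.linearMap_ext _ fun j => LinearMap.ext fun v => ?_
    have hA := LinearMap.congr_fun (F j).counit v
    simp only [LinearMap.comp_apply] at hA
    simp only [LinearMap.comp_apply, DirectSum.toModule_lof]
    rw [← rTensor_lTensor, hA]
    simp

/-- A comodule is indecomposable if it is nonzero and if, whenever it is isomorphic to a direct
sum of two comodules, one of these is zero. -/
def Indecomposable (V : Comod 𝕜 H) : Prop :=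
  Nontrivial V.carrier ∧ ∀ A B : Comod 𝕜 H, V.Iso (A.prod B) →
    Subsingleton A.carrier ∨ Subsingleton B.carrier

end Comod

infix:25 " ≅ᶜ " => Comod.Iso
infixl:70 " ⊗ᶜ " => Comod.tensor
infixl:65 " ⊕ᶜ " => Comod.prod

/-! ## The comodules `V(i, l)` -/

namespace CyclicPath

variable {𝕜 : Type u} [Field 𝕜] {n : ℕ} [NeZero n] (q : rootsOfUnity n 𝕜)

/-- The structure map of `V(i, l)`: the basis is `v_0, …, v_l`, and
`v_m ↦ ∑_{m ≤ j ≤ l} v_j ⊗ p_{i + m}^{j - m}`. -/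
def stringCoact (i : ZMod n) (l : ℕ) :
    (Fin (l + 1) →₀ 𝕜) →ₗ[𝕜] (Fin (l + 1) →₀ 𝕜) ⊗[𝕜] CyclicPath q :=
  Finsupp.linearCombination 𝕜 fun m : Fin (l + 1) => ∑ j ∈ Finset.Ici m,
    Finsupp.single j (1 : 𝕜) ⊗ₜ[𝕜] path q (i + ((m : ℕ) : ZMod n)) ((j : ℕ) - (m : ℕ))

theorem stringCoact_single (i : ZMod n) (l : ℕ) (m : Fin (l + 1)) :
    stringCoact q i l (Finsupp.single m 1) = ∑ j ∈ Finset.Ici m,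
      Finsupp.single j (1 : 𝕜) ⊗ₜ[𝕜] path q (i + ((m : ℕ) : ZMod n)) ((j : ℕ) - (m : ℕ)) := by
  simp [stringCoact]

/-- The comodule `V(i, l)`, of dimension `l + 1`. -/
def V (i : ZMod n) (l : ℕ) : Comod 𝕜 (CyclicPath q) where
  carrier := Fin (l + 1) →₀ 𝕜
  coact := stringCoact q i l
  coassoc := by
    refine Finsupp.lhom_ext' fun m => LinearMap.ext_ring ?_
    simp only [LinearMap.comp_apply, Finsupp.lsingle_apply, stringCoact_single, map_sum,
      LinearMap.rTensor_tmul, LinearMap.lTensor_tmul, TensorProduct.sum_tmul, comul_path,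
      TensorProduct.tmul_sum, LinearEquiv.coe_coe, TensorProduct.assoc_tmul]
    rw [Finset.sum_comm' (s := Finset.Ici m) (t := fun j => Finset.Ici j) (t' := Finset.Ici m)
      (s' := fun x => Finset.Icc m x) (by
        intro x y
        simp only [Finset.mem_Ici, Finset.mem_Icc]
        exact ⟨fun h => ⟨h, h.1.trans h.2⟩, fun h => h.1⟩)]
    refine Finset.sum_congr rfl fun x hx => ?_
    have hx' : m ≤ x := by simpa using hx
    have hx2 : (m : ℕ) ≤ x := hx'
    refine Finset.sum_bij' (fun j _ => ((x : ℕ) - (j : ℕ), (j : ℕ) - (m : ℕ)))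
      (fun c _ => ⟨min ((m : ℕ) + c.2) l, by omega⟩) ?_ ?_ ?_ ?_ ?_
    · intro j hj
      have h1 := (Finset.mem_Icc.1 hj).1
      have h2 := (Finset.mem_Icc.1 hj).2
      rw [Fin.le_def] at h1 h2
      exact Finset.HasAntidiagonal.mem_antidiagonal.2 (by omega)
    · intro c hc
      have hc' := Finset.HasAntidiagonal.mem_antidiagonal.1 hc
      have := x.2
      refine Finset.mem_Icc.2 ⟨?_, ?_⟩
      · rw [Fin.le_def]
        dsimp only
        omega
      · rw [Fin.le_def]
        dsimp only
        omega
    · intro j hj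
      have h1 := (Finset.mem_Icc.1 hj).1
      have h2 := (Finset.mem_Icc.1 hj).2
      rw [Fin.le_def] at h1 h2
      have := j.2
      refine Fin.ext ?_
      dsimp only
      omega
    · rintro ⟨a, b⟩ hc
      have hc' := Finset.HasAntidiagonal.mem_antidiagonal.1 hc
      dsimp only at hc'
      have := x.2
      refine Prod.ext ?_ ?_
      · dsimp only
        omega
      · dsimp only
        omega
    · intro j hj
      simp only [Finset.mem_Icc, Fin.le_def] at hj
      have h : ((j : ℕ) : ZMod n) = ((m : ℕ) : ZMod n) + (((j : ℕ) - (m : ℕ) : ℕ) : ZMod n) := by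
        rw [← Nat.cast_add]
        congr 1
        omega
      rw [h, add_assoc]
  counit := by
    refine Finsupp.lhom_ext' fun m => LinearMap.ext_ring ?_
    simp only [LinearMap.comp_apply, Finsupp.lsingle_apply, stringCoact_single, map_sum,
      LinearMap.lTensor_tmul, counit_path]
    rw [Finset.sum_eq_single m]
    · simp
    · intro j hj hne
      have hj' : m ≤ j := by simpa using hj
      have : (m : ℕ) < j := lt_of_le_of_ne hj' fun h => hne (Fin.ext h.symm)
      rw [if_neg (by omega)]
      simp
    · simp

end CyclicPath

end

open CyclicPath (V)

/-! A finite dimensional comodule over the path coalgebra amounts to a `ZMod n`-graded space with a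
nilpotent operator T of degree one (`shift`); V(i, l) is a single Jordan block whose generator has
degree i. Its kernel of T is a line, while two nonzero summands would contribute two independent
kernel vectors, so V(i, l) is indecomposable.

On V(0, a) ⊗ V(0, c) the operator sends v_i ⊗ v_j to v_{i+1} ⊗ v_j + q^i v_i ⊗ v_{j+1}. This is left
multiplication by x + y on the monomials x^i y^j of the quantum plane yx = qxy, truncated at x^{a+1}
and y^{c+1}. Modulo the image of T every monomial of degree s is a nonzero multiple of v_0 ⊗ v_s,
and for s > a the latter lies in the image. Hence, given for every s ≤ a a vector x_s = r v_0 ⊗ v_s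
+ T w, with r nonzero and w in degree s - 1, such that T^{L_s + 1} x_s = 0, the strings generated by
the x_s define a surjection from the sum of the V(s, L_s). It is an isomorphism as soon as the
dimensions agree (`cls_tensor`). The theorem thus reduces to producing the x_s and counting.

There are two sources of such vectors. The first is the Clebsch-Gordan length L_s = a + c - 2s. Here
T^{L_s + 1} lands in a degree of dimension s, so killing v_0 ⊗ v_s by s correction terms is a square
linear system of Gaussian binomials. Its determinant is, up to a power of q, a quotient of products
of q-factorials (`det_qMatrix_mul`). With q replaced by a variable, the multiplicity of a primitive
d-th root of unity in the q-factorial of m is the floor of m / d, so the determinant survives at q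
when two sums of floors agree (`det_qMatrix_ne_zero`). The second is T^d, which acts as x^d + y^d,
because the intermediate Gaussian binomials vanish at q. On each sublattice of step d this is the
same problem with q = 1, always solvable in characteristic 0, and it yields strings whose dimension
is a multiple of d (`exists_gridLead_of_dvd`).

Writing s = kd + i, the residue i decides which source applies. -/

/-! ### Morphisms, isomorphisms and direct sums of comodules -/

namespace Comod

variable {𝕜 : Type u} {H : Type u} [Field 𝕜] [Ring H] [Bialgebra 𝕜 H]

/-- A linear map is a morphism of comodules if it commutes with the structure maps. -/
def IsHom (A B : Comod 𝕜 H) (f : A.carrier →ₗ[𝕜] B.carrier) : Prop :=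
  f.rTensor H ∘ₗ A.coact = B.coact ∘ₗ f

variable {A B C D : Comod 𝕜 H}

theorem IsHom.id (A : Comod 𝕜 H) : IsHom A A LinearMap.id := by
  simp [IsHom]

theorem IsHom.comp {f : A.carrier →ₗ[𝕜] B.carrier} {g : B.carrier →ₗ[𝕜] C.carrier}
    (hg : IsHom B C g) (hf : IsHom A B f) : IsHom A C (g ∘ₗ f) := by
  unfold IsHom at *
  rw [LinearMap.rTensor_comp, LinearMap.comp_assoc, hf, ← LinearMap.comp_assoc, hg,
    LinearMap.comp_assoc]

theorem IsHom.symm {e : A.carrier ≃ₗ[𝕜] B.carrier} (he : IsHom A B e) :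
    IsHom B A (e.symm : B.carrier →ₗ[𝕜] A.carrier) := by
  unfold IsHom at *
  have h1 : (e.symm : B.carrier →ₗ[𝕜] A.carrier) ∘ₗ (e : A.carrier →ₗ[𝕜] B.carrier) =
      LinearMap.id := by ext; simp
  have h2 : (e : A.carrier →ₗ[𝕜] B.carrier) ∘ₗ (e.symm : B.carrier →ₗ[𝕜] A.carrier) =
      LinearMap.id := by ext; simp
  calc _ = (e.symm : B.carrier →ₗ[𝕜] A.carrier).rTensor H ∘ₗ (B.coact ∘ₗ
        (e : A.carrier →ₗ[𝕜] B.carrier)) ∘ₗ (e.symm : B.carrier →ₗ[𝕜] A.carrier) := by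
          rw [LinearMap.comp_assoc, h2, LinearMap.comp_id]
    _ = _ := by
      rw [← he, ← LinearMap.comp_assoc, ← LinearMap.comp_assoc, ← LinearMap.rTensor_comp, h1,
        LinearMap.rTensor_id, LinearMap.id_comp]

theorem Iso.refl (A : Comod 𝕜 H) : A.Iso A := ⟨LinearEquiv.refl 𝕜 _, IsHom.id A⟩

theorem Iso.symm (h : A.Iso B) : B.Iso A := by
  obtain ⟨e, he⟩ := h
  exact ⟨e.symm, IsHom.symm he⟩

theorem Iso.trans (h : A.Iso B) (h' : B.Iso C) : A.Iso C := by
  obtain ⟨e, he⟩ := h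
  obtain ⟨e', he'⟩ := h'
  exact ⟨e.trans e', IsHom.comp (f := (e : A.carrier →ₗ[𝕜] B.carrier))
    (g := (e' : B.carrier →ₗ[𝕜] C.carrier)) he' he⟩

/-- Finite dimension makes an inverse unnecessary: a surjection between spaces of equal dimension is
bijective. The isomorphisms for direct sums and the main decomposition all arise this way. -/
theorem IsHom.iso_of_surjective {f : A.carrier →ₗ[𝕜] B.carrier} (hf : IsHom A B f)
    (hs : Function.Surjective f)
    (hr : Module.finrank 𝕜 A.carrier = Module.finrank 𝕜 B.carrier) : A.Iso B :=
  ⟨LinearEquiv.ofBijective f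
    ⟨(LinearMap.injective_iff_surjective_of_finrank_eq_finrank hr).2 hs, hs⟩, hf⟩

theorem Iso.finrank_eq (h : A.Iso B) :
    Module.finrank 𝕜 A.carrier = Module.finrank 𝕜 B.carrier := by
  obtain ⟨e, -⟩ := h
  exact e.finrank_eq

/-- The inclusion of the first summand. -/
def inl (A B : Comod 𝕜 H) : A.carrier →ₗ[𝕜] (A.prod B).carrier :=
  LinearMap.inl 𝕜 A.carrier B.carrier

/-- The inclusion of the second summand. -/
def inr (A B : Comod 𝕜 H) : B.carrier →ₗ[𝕜] (A.prod B).carrier :=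
  LinearMap.inr 𝕜 A.carrier B.carrier

/-- The linear map out of a direct sum with given restrictions to the summands. -/
def desc (f : A.carrier →ₗ[𝕜] C.carrier) (g : B.carrier →ₗ[𝕜] C.carrier) :
    (A.prod B).carrier →ₗ[𝕜] C.carrier :=
  LinearMap.coprod f g

theorem desc_comp_inl (f : A.carrier →ₗ[𝕜] C.carrier) (g : B.carrier →ₗ[𝕜] C.carrier) :
    desc f g ∘ₗ inl A B = f :=
  LinearMap.coprod_inl f g

theorem desc_comp_inr (f : A.carrier →ₗ[𝕜] C.carrier) (g : B.carrier →ₗ[𝕜] C.carrier) :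
    desc f g ∘ₗ inr A B = g :=
  LinearMap.coprod_inr f g

theorem desc_inl (f : A.carrier →ₗ[𝕜] C.carrier) (g : B.carrier →ₗ[𝕜] C.carrier)
    (x : A.carrier) : desc f g (inl A B x) = f x :=
  LinearMap.congr_fun (desc_comp_inl f g) x

theorem desc_inr (f : A.carrier →ₗ[𝕜] C.carrier) (g : B.carrier →ₗ[𝕜] C.carrier)
    (x : B.carrier) : desc f g (inr A B x) = g x :=
  LinearMap.congr_fun (desc_comp_inr f g) x

theorem prod_hom_ext {M : Type*} [AddCommGroup M] [Module 𝕜 M]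
    {f g : (A.prod B).carrier →ₗ[𝕜] M} (hl : f ∘ₗ inl A B = g ∘ₗ inl A B)
    (hr : f ∘ₗ inr A B = g ∘ₗ inr A B) : f = g :=
  LinearMap.prod_ext (M := A.carrier) (M₂ := B.carrier) hl hr

theorem exists_eq_inl_add_inr (x : (A.prod B).carrier) :
    ∃ a b, x = inl A B a + inr A B b :=
  ⟨x.1, x.2, Prod.ext (add_zero x.1).symm (zero_add x.2).symm⟩

theorem isHom_inl (A B : Comod 𝕜 H) : IsHom A (A.prod B) (inl A B) :=
  (LinearMap.coprod_inl (M := A.carrier) (M₂ := B.carrier) _ _).symm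

theorem isHom_inr (A B : Comod 𝕜 H) : IsHom B (A.prod B) (inr A B) :=
  (LinearMap.coprod_inr (M := A.carrier) (M₂ := B.carrier) _ _).symm

theorem IsHom.desc {f : A.carrier →ₗ[𝕜] C.carrier} {g : B.carrier →ₗ[𝕜] C.carrier}
    (hf : IsHom A C f) (hg : IsHom B C g) : IsHom (A.prod B) C (desc f g) := by
  have hl : _ = _ := isHom_inl A B
  have hr : _ = _ := isHom_inr A B
  unfold IsHom at *
  refine prod_hom_ext ?_ ?_
  · rw [LinearMap.comp_assoc, LinearMap.comp_assoc, desc_comp_inl, ← hl, ← LinearMap.comp_assoc,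
      ← LinearMap.rTensor_comp, desc_comp_inl, hf]
  · rw [LinearMap.comp_assoc, LinearMap.comp_assoc, desc_comp_inr, ← hr, ← LinearMap.comp_assoc,
      ← LinearMap.rTensor_comp, desc_comp_inr, hg]

theorem surjective_of_inl_inr {M : Type*} [AddCommGroup M] [Module 𝕜 M]
    {f : M →ₗ[𝕜] (A.prod B).carrier} (hl : ∀ a, inl A B a ∈ LinearMap.range f)
    (hr : ∀ b, inr A B b ∈ LinearMap.range f) : Function.Surjective f := by
  intro x
  obtain ⟨a, b, rfl⟩ := exists_eq_inl_add_inr x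
  exact Submodule.add_mem _ (hl a) (hr b)

/-- The inclusion of a summand. -/
def incl (s : Finset ℕ) (F : ℕ → Comod 𝕜 H) (j : s) : (F j).carrier →ₗ[𝕜] (sum s F).carrier :=
  DirectSum.lof 𝕜 s (fun j : s => (F j).carrier) j

/-- The linear map out of a direct sum with given restrictions to the summands. -/
def sumDesc (s : Finset ℕ) (F : ℕ → Comod 𝕜 H)
    (f : (j : s) → (F j).carrier →ₗ[𝕜] C.carrier) : (sum s F).carrier →ₗ[𝕜] C.carrier :=
  DirectSum.toModule 𝕜 s C.carrier f

theorem sumDesc_incl (s : Finset ℕ) (F : ℕ → Comod 𝕜 H)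
    (f : (j : s) → (F j).carrier →ₗ[𝕜] C.carrier) (j : s) (v : (F j).carrier) :
    sumDesc s F f (incl s F j v) = f j v :=
  DirectSum.toModule_lof (M := fun j : s => (F j).carrier) 𝕜 j v

theorem sumDesc_comp_incl (s : Finset ℕ) (F : ℕ → Comod 𝕜 H)
    (f : (j : s) → (F j).carrier →ₗ[𝕜] C.carrier) (j : s) :
    sumDesc s F f ∘ₗ incl s F j = f j :=
  LinearMap.ext fun v => sumDesc_incl s F f j v

theorem sum_hom_ext {s : Finset ℕ} {F : ℕ → Comod 𝕜 H} {M : Type*} [AddCommGroup M] [Module 𝕜 M]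
    {f g : (sum s F).carrier →ₗ[𝕜] M} (h : ∀ j, f ∘ₗ incl s F j = g ∘ₗ incl s F j) : f = g :=
  DirectSum.linearMap_ext (M := fun j : s => (F j).carrier) 𝕜 h

theorem isHom_incl (s : Finset ℕ) (F : ℕ → Comod 𝕜 H) (j : s) :
    IsHom (F j) (sum s F) (incl s F j) :=
  LinearMap.ext fun v => (DirectSum.toModule_lof (M := fun j : s => (F j).carrier)
    (N := (⨁ j : s, (F j).carrier) ⊗[𝕜] H)
    (φ := fun j => (DirectSum.lof 𝕜 s (fun j : s => (F j).carrier) j).rTensor H ∘ₗ (F j).coact)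
    𝕜 j v).symm

theorem IsHom.sumDesc (s : Finset ℕ) (F : ℕ → Comod 𝕜 H)
    {f : (j : s) → (F j).carrier →ₗ[𝕜] C.carrier} (hf : ∀ j : s, IsHom (F j) C (f j)) :
    IsHom (sum s F) C (sumDesc s F f) := by
  refine sum_hom_ext fun j => ?_
  have hi : _ = _ := isHom_incl s F j
  have hj : _ = _ := hf j
  rw [LinearMap.comp_assoc, LinearMap.comp_assoc, sumDesc_comp_incl, ← hi, ← LinearMap.comp_assoc,
    ← LinearMap.rTensor_comp, sumDesc_comp_incl, hj]

theorem surjective_of_incl {s : Finset ℕ} {F : ℕ → Comod 𝕜 H} {M : Type*} [AddCommGroup M]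
    [Module 𝕜 M] {f : M →ₗ[𝕜] (sum s F).carrier}
    (h : ∀ j v, incl s F j v ∈ LinearMap.range f) : Function.Surjective f := by
  intro x
  change x ∈ LinearMap.range f
  exact DirectSum.induction_on (β := fun j : s => (F j).carrier)
    (motive := fun x => x ∈ LinearMap.range f) x
    (Submodule.zero_mem _) (fun j v => h j v) fun x y hx hy => Submodule.add_mem _ hx hy

theorem finrank_prod (A B : Comod 𝕜 H) : Module.finrank 𝕜 (A.prod B).carrier =
    Module.finrank 𝕜 A.carrier + Module.finrank 𝕜 B.carrier :=
  Module.finrank_prod (R := 𝕜) (M := A.carrier) (M' := B.carrier)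

theorem finrank_sum (s : Finset ℕ) (F : ℕ → Comod 𝕜 H) : Module.finrank 𝕜 (sum s F).carrier =
    ∑ j ∈ s, Module.finrank 𝕜 (F j).carrier := by
  refine (Module.finrank_directSum (R := 𝕜) (fun j : s => (F j).carrier)).trans ?_
  exact Finset.sum_coe_sort s fun j => Module.finrank 𝕜 (F j).carrier

theorem prod_congr (h : A.Iso B) (h' : C.Iso D) : (A.prod C).Iso (B.prod D) := by
  have hr : Module.finrank 𝕜 (A.prod C).carrier = Module.finrank 𝕜 (B.prod D).carrier := by
    rw [finrank_prod, finrank_prod, h.finrank_eq, h'.finrank_eq]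
  obtain ⟨e, he⟩ := h
  obtain ⟨e', he'⟩ := h'
  refine IsHom.iso_of_surjective (((isHom_inl B D).comp he).desc ((isHom_inr B D).comp he'))
    (surjective_of_inl_inr (fun b => ⟨inl A C (e.symm b), ?_⟩)
      fun b => ⟨inr A C (e'.symm b), ?_⟩) hr
  · simp [desc_inl]
  · simp [desc_inr]

theorem prod_comm (A B : Comod 𝕜 H) : (A.prod B).Iso (B.prod A) := by
  refine IsHom.iso_of_surjective ((isHom_inr B A).desc (isHom_inl B A))
    (surjective_of_inl_inr (fun b => ⟨inr A B b, desc_inr _ _ _⟩)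
      fun b => ⟨inl A B b, desc_inl _ _ _⟩)
    (by rw [finrank_prod, finrank_prod, add_comm])

theorem prod_assoc (A B C : Comod 𝕜 H) : ((A.prod B).prod C).Iso (A.prod (B.prod C)) := by
  refine IsHom.iso_of_surjective (((isHom_inl A (B.prod C)).desc
    ((isHom_inr A (B.prod C)).comp (isHom_inl B C))).desc
    ((isHom_inr A (B.prod C)).comp (isHom_inr B C)))
    (surjective_of_inl_inr (fun a => ⟨inl _ _ (inl _ _ a), ?_⟩) fun x => ?_)
    (by simp only [finrank_prod, add_assoc])
  · simp [desc_inl]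
  · obtain ⟨b, c, rfl⟩ := exists_eq_inl_add_inr x
    refine ⟨inl _ _ (inr _ _ b) + inr _ _ c, ?_⟩
    simp [desc_inl, desc_inr]

/-- The zero comodule. -/
def zero (𝕜 H : Type u) [Field 𝕜] [Ring H] [Bialgebra 𝕜 H] : Comod 𝕜 H where
  carrier := PUnit.{u + 1}
  coact := 0
  coassoc := LinearMap.ext fun v => by simp
  counit := LinearMap.ext fun v => by
    rw [Subsingleton.elim v 0, map_zero, map_zero]

instance : Subsingleton (zero 𝕜 H).carrier := inferInstanceAs (Subsingleton PUnit)

theorem zero_prod (A : Comod 𝕜 H) : ((zero 𝕜 H).prod A).Iso A := by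
  refine IsHom.iso_of_surjective (f := desc 0 LinearMap.id)
    (IsHom.desc (by simp [IsHom]) (IsHom.id A)) (fun x => ⟨inr _ _ x, desc_inr _ _ _⟩) ?_
  rw [finrank_prod, Module.finrank_zero_of_subsingleton, zero_add]

theorem sum_empty (F : ℕ → Comod 𝕜 H) : (sum ∅ F).Iso (zero 𝕜 H) := by
  refine IsHom.iso_of_surjective (f := 0) (by simp [IsHom])
    (fun x => ⟨0, Subsingleton.elim _ _⟩) ?_
  rw [finrank_sum, Finset.sum_empty, Module.finrank_zero_of_subsingleton]

theorem sum_insert {s : Finset ℕ} {j : ℕ} (hj : j ∉ s) (F : ℕ → Comod 𝕜 H) :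
    ((F j).prod (sum s F)).Iso (sum (insert j s) F) := by
  refine IsHom.iso_of_surjective (IsHom.desc
    (isHom_incl (insert j s) F ⟨j, Finset.mem_insert_self j s⟩)
    (IsHom.sumDesc s F (f := fun k : s => incl (insert j s) F
      ⟨k, Finset.mem_insert_of_mem k.2⟩) fun k => isHom_incl (insert j s) F _))
    (surjective_of_incl ?_) ?_
  · rintro ⟨k, hk⟩ v
    rcases Finset.mem_insert.1 hk with rfl | hk'
    · exact ⟨inl _ _ v, desc_inl _ _ _⟩
    · exact ⟨inr _ _ (incl s F ⟨k, hk'⟩ v), (desc_inr _ _ _).trans (sumDesc_incl _ _ _ _ _)⟩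
  · rw [finrank_prod, finrank_sum, finrank_sum, Finset.sum_insert hj]

/-! ### The commutative monoid of isomorphism classes, where regrouping direct sums becomes
rearranging finite sums -/

/-- Isomorphism as an equivalence relation. -/
def isoSetoid (𝕜 H : Type u) [Field 𝕜] [Ring H] [Bialgebra 𝕜 H] : Setoid (Comod 𝕜 H) where
  r := Iso
  iseqv := ⟨Iso.refl, Iso.symm, Iso.trans⟩

/-- Isomorphism classes of comodules. -/
def IsoClass (𝕜 H : Type u) [Field 𝕜] [Ring H] [Bialgebra 𝕜 H] : Type (u + 1) :=
  Quotient (isoSetoid 𝕜 H)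

/-- The isomorphism class of a comodule. -/
def cls (A : Comod 𝕜 H) : IsoClass 𝕜 H := Quotient.mk (isoSetoid 𝕜 H) A

theorem cls_eq_iff : A.cls = B.cls ↔ A.Iso B :=
  Quotient.eq (r := isoSetoid 𝕜 H)

instance : Add (IsoClass 𝕜 H) :=
  ⟨Quotient.map₂ prod fun _ _ h _ _ h' => prod_congr h h'⟩

instance : Zero (IsoClass 𝕜 H) := ⟨(zero 𝕜 H).cls⟩

theorem cls_prod (A B : Comod 𝕜 H) : (A.prod B).cls = A.cls + B.cls := rfl

theorem IsoClass.zero_add' (a : IsoClass 𝕜 H) : 0 + a = a := by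
  induction a using Quotient.inductionOn with
  | h A => exact cls_eq_iff.2 (zero_prod A)

theorem IsoClass.add_comm' (a b : IsoClass 𝕜 H) : a + b = b + a := by
  induction a using Quotient.inductionOn with
  | h A =>
    induction b using Quotient.inductionOn with
    | h B => exact cls_eq_iff.2 (prod_comm A B)

instance : AddCommMonoid (IsoClass 𝕜 H) where
  add_assoc a b c := by
    induction a using Quotient.inductionOn with
    | h A =>
      induction b using Quotient.inductionOn with
      | h B =>
        induction c using Quotient.inductionOn with
        | h C => exact cls_eq_iff.2 (prod_assoc A B C)
  zero_add := IsoClass.zero_add'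
  add_zero a := by rw [IsoClass.add_comm', IsoClass.zero_add']
  add_comm := IsoClass.add_comm'
  nsmul := nsmulRec

theorem cls_sum (s : Finset ℕ) (F : ℕ → Comod 𝕜 H) : (sum s F).cls = ∑ j ∈ s, (F j).cls := by
  induction s using Finset.induction_on with
  | empty => exact cls_eq_iff.2 (sum_empty F)
  | insert j s hj ih =>
    rw [Finset.sum_insert hj, ← ih, ← cls_prod, cls_eq_iff]
    exact (sum_insert hj F).symm

end Comod

/-! ### Comodules as graded spaces with an operator of degree one -/

namespace CyclicPath

open Comod (IsHom)

variable {𝕜 : Type u} [Field 𝕜] {n : ℕ} (q : rootsOfUnity n 𝕜)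

noncomputable section

/-- The coordinate functional at the path of length `l` that starts at `i`. -/
def coord (i : ZMod n) (l : ℕ) : CyclicPath q →ₗ[𝕜] 𝕜 :=
  lift q fun j m => if j = i ∧ m = l then 1 else 0

theorem coord_path (i j : ZMod n) (l m : ℕ) :
    coord q i l (path q j m) = if j = i ∧ m = l then 1 else 0 :=
  lift_path _ _ _

/-- The coefficient at the path of length `l` that starts at `i`. -/
def coeff (M : Type*) [AddCommGroup M] [Module 𝕜 M] (i : ZMod n) (l : ℕ) :
    M ⊗[𝕜] CyclicPath q →ₗ[𝕜] M :=
  (TensorProduct.rid 𝕜 M).toLinearMap ∘ₗ (coord q i l).lTensor M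

variable {M N : Type*} [AddCommGroup M] [Module 𝕜 M] [AddCommGroup N] [Module 𝕜 N]

variable {q} in
@[simp] theorem coeff_tmul (i : ZMod n) (l : ℕ) (m : M) (x : CyclicPath q) :
    coeff q M i l (m ⊗ₜ x) = coord q i l x • m := by
  simp [coeff]

variable {q} in
theorem coeff_tmul_path (i j : ZMod n) (l k : ℕ) (m : M) :
    coeff q M i l (m ⊗ₜ path q j k) = if j = i ∧ k = l then m else 0 := by
  rw [coeff_tmul, coord_path, ite_smul, one_smul, zero_smul]

variable {q} in
theorem coeff_rTensor (f : M →ₗ[𝕜] N) (i : ZMod n) (l : ℕ) (x : M ⊗[𝕜] CyclicPath q) :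
    coeff q N i l (f.rTensor _ x) = f (coeff q M i l x) := by
  induction x with
  | zero => simp
  | add x y hx hy => simp only [map_add, hx, hy]
  | tmul m h => simp

/-- An element of `M ⊗ CyclicPath q` is determined by its coefficients. -/
def coeffEquiv (M : Type*) [AddCommGroup M] [Module 𝕜 M] :
    M ⊗[𝕜] CyclicPath q ≃ₗ[𝕜] ((ZMod n × ℕ) →₀ M) := by
  classical
  exact TensorProduct.finsuppScalarRight 𝕜 𝕜 M (ZMod n × ℕ)

variable {q} in
theorem coeffEquiv_apply (x : M ⊗[𝕜] CyclicPath q) (i : ZMod n) (l : ℕ) :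
    coeffEquiv q M x (i, l) = coeff q M i l x := by
  classical
  induction x with
  | zero => simp
  | add x y hx hy => rw [map_add, map_add, Finsupp.add_apply, hx, hy]
  | tmul m h =>
    induction h using induction with
    | h0 => simp
    | hadd x y hx hy => rw [TensorProduct.tmul_add, map_add, map_add, Finsupp.add_apply, hx, hy]
    | hsmul a j k =>
      rw [TensorProduct.tmul_smul, map_smul, map_smul, Finsupp.smul_apply, coeff_tmul_path]
      congr 1
      have : coeffEquiv q M (m ⊗ₜ path q j k) = Finsupp.single (j, k) m := by
        refine (TensorProduct.finsuppScalarRight_apply_tmul (R := 𝕜) (S := 𝕜) m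
          (Finsupp.single (j, k) (1 : 𝕜))).trans ?_
        simp
      rw [this, Finsupp.single_apply]
      simp [Prod.ext_iff]

variable {q} in
theorem tensor_ext {x y : M ⊗[𝕜] CyclicPath q}
    (h : ∀ i l, coeff q M i l x = coeff q M i l y) : x = y := by
  refine (coeffEquiv q M).injective (Finsupp.ext fun a => ?_)
  rw [coeffEquiv_apply x a.1 a.2, coeffEquiv_apply y a.1 a.2, h]

/-- The coefficient in `M ⊗ (H ⊗ H)` at a pair of paths. -/
def coeff₂ (M : Type*) [AddCommGroup M] [Module 𝕜 M] (j i : ZMod n) (a b : ℕ) :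
    M ⊗[𝕜] (CyclicPath q ⊗[𝕜] CyclicPath q) →ₗ[𝕜] M :=
  (TensorProduct.rid 𝕜 M).toLinearMap ∘ₗ
    (LinearMap.mul' 𝕜 𝕜 ∘ₗ TensorProduct.map (coord q j a) (coord q i b)).lTensor M

variable {q} in
theorem coeff₂_tmul (j i : ZMod n) (a b : ℕ) (m : M) (x y : CyclicPath q) :
    coeff₂ q M j i a b (m ⊗ₜ (x ⊗ₜ y)) = (coord q j a x * coord q i b y) • m := by
  simp [coeff₂]

variable {q} in
theorem coeff₂_assoc (j i : ZMod n) (a b : ℕ) (x : (M ⊗[𝕜] CyclicPath q) ⊗[𝕜] CyclicPath q) :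
    coeff₂ q M j i a b (TensorProduct.assoc 𝕜 M _ _ x) = coeff q M j a (coeff q _ i b x) := by
  induction x with
  | zero => simp
  | add x y hx hy => simp only [map_add, hx, hy]
  | tmul y h =>
    induction y with
    | zero => simp
    | add x y hx hy => simp only [TensorProduct.add_tmul, map_add, hx, hy]
    | tmul m h' =>
      rw [TensorProduct.assoc_tmul, coeff₂_tmul, coeff_tmul, map_smul, coeff_tmul, smul_smul,
        mul_comm]

variable [NeZero n]

variable {q} in
/-- The coefficient of the structure map of a comodule at a path. -/
def act (W : Comod 𝕜 (CyclicPath q)) (i : ZMod n) (l : ℕ) : W.carrier →ₗ[𝕜] W.carrier :=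
  coeff q W.carrier i l ∘ₗ W.coact

variable {q}
variable (W W' : Comod 𝕜 (CyclicPath q))

theorem act_apply (i : ZMod n) (l : ℕ) (v : W.carrier) :
    act W i l v = coeff q W.carrier i l (W.coact v) := rfl

variable {W W'} in
-- An element of M ⊗ `CyclicPath q` is determined by its coefficients at paths, so compatibility
-- with the coaction can be tested on coefficient operators.
theorem isHom_iff {f : W.carrier →ₗ[𝕜] W'.carrier} :
    IsHom W W' f ↔ ∀ i l v, f (act W i l v) = act W' i l (f v) := by
  refine ⟨fun h i l v => ?_, fun h => LinearMap.ext fun v => tensor_ext fun i l => ?_⟩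
  · rw [act_apply, act_apply, ← coeff_rTensor]
    exact congrArg _ (LinearMap.congr_fun h v)
  · rw [LinearMap.comp_apply, LinearMap.comp_apply, coeff_rTensor]
    exact h i l v

theorem coeff₂_comul (j i : ZMod n) (a b : ℕ) (x : M ⊗[𝕜] CyclicPath q) :
    coeff₂ q M j i a b ((Coalgebra.comul (R := 𝕜) (A := CyclicPath q)).lTensor M x) =
      if j = i + b then coeff q M i (a + b) x else 0 := by
  induction x with
  | zero => simp
  | add x y hx hy =>
    simp only [map_add, hx, hy]
    split_ifs <;> simp
  | tmul m h =>
    induction h using induction with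
    | h0 => simp
    | hadd x y hx hy =>
      simp only [TensorProduct.tmul_add, map_add, hx, hy]
      split_ifs <;> simp
    | hsmul c k l =>
      rw [TensorProduct.tmul_smul, map_smul, map_smul, map_smul, LinearMap.lTensor_tmul, comul_path,
        TensorProduct.tmul_sum, map_sum]
      simp only [coeff₂_tmul, coord_path, coeff_tmul]
      rw [← smul_ite_zero]
      congr 1
      -- A path has exactly one splitting with final part of length a and initial part of length b,
      -- so at most one term of the comultiplication contributes.
      by_cases hc : (k = i ∧ l = a + b) ∧ j = i + b
      · obtain ⟨⟨rfl, rfl⟩, rfl⟩ := hc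
        rw [Finset.sum_eq_single (a, b)]
        · simp
        · rintro ⟨x, y⟩ - h2
          have : ¬ (y = b ∧ x = a) := by
            rintro ⟨rfl, rfl⟩
            exact h2 rfl
          by_cases hy : y = b
          · subst hy
            simp [show x ≠ a by tauto]
          · simp [hy]
        · simp
      · rw [Finset.sum_eq_zero]
        · split_ifs with h1 h2 <;> simp_all
        · rintro ⟨x, y⟩ hx
          have hx' : x + y = l := by simpa using hx
          rw [ite_mul, zero_mul, one_mul, ← ite_and, if_neg, zero_smul]
          rintro ⟨⟨h1, h2⟩, h3, h4⟩
          refine hc ⟨⟨h3, ?_⟩, ?_⟩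
          · omega
          · simp_all

/-- This is coassociativity read at a pair of paths. In particular the operators `act W i 0` are
orthogonal idempotents, the projections onto the degrees. -/
theorem act_act (j i : ZMod n) (a b : ℕ) (v : W.carrier) :
    act W j a (act W i b v) = if j = i + b then act W i (a + b) v else 0 := by
  have h := LinearMap.congr_fun W.coassoc v
  simp only [LinearMap.comp_apply, LinearEquiv.coe_coe] at h
  have h' := congrArg (coeff₂ q W.carrier j i a b) h
  rw [coeff₂_assoc, coeff₂_comul, coeff_rTensor] at h'
  exact h'

/-- The action of the sum of all arrows. -/
def shift : W.carrier →ₗ[𝕜] W.carrier := ∑ i, act W i 1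

theorem shift_act (i : ZMod n) (l : ℕ) (v : W.carrier) :
    shift W (act W i l v) = act W i (l + 1) v := by
  simp only [shift, LinearMap.sum_apply, act_act, Finset.sum_ite_eq', Finset.mem_univ, if_true,
    add_comm 1 l]

theorem act_eq_shift_pow (i : ZMod n) (l : ℕ) (v : W.carrier) :
    act W i l v = (shift W ^ l) (act W i 0 v) := by
  induction l with
  | zero => simp
  | succ l ih => rw [← shift_act, ih, pow_succ', Module.End.mul_apply]

theorem act_zero_shift (i : ZMod n) (v : W.carrier) :
    act W (i + 1) 0 (shift W v) = shift W (act W i 0 v) := by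
  rw [shift_act, shift, LinearMap.sum_apply, map_sum]
  simp only [act_act, Nat.cast_one, zero_add, add_left_inj, Finset.sum_ite_eq, Finset.mem_univ,
    if_true]

variable {W W'} in
-- Each coefficient operator is a degree projection followed by a power of `shift`, so the
-- projections and `shift` carry the whole comodule structure.
theorem isHom_of_shift {f : W.carrier →ₗ[𝕜] W'.carrier}
    (h0 : ∀ i v, f (act W i 0 v) = act W' i 0 (f v))
    (h1 : ∀ v, f (shift W v) = shift W' (f v)) : IsHom W W' f := by
  refine isHom_iff.2 fun i l v => ?_
  rw [act_eq_shift_pow, act_eq_shift_pow W', ← h0]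
  generalize act W i 0 v = w
  induction l with
  | zero => simp
  | succ l ih => rw [pow_succ', pow_succ', Module.End.mul_apply, Module.End.mul_apply, h1, ih]

variable {W W'} in
theorem _root_.Comod.IsHom.map_shift {f : W.carrier →ₗ[𝕜] W'.carrier} (h : IsHom W W' f)
    (v : W.carrier) : f (shift W v) = shift W' (f v) := by
  simp only [shift, LinearMap.sum_apply, map_sum, isHom_iff.1 h]

variable {W} in
/-- If `v` is in degree `i`, then `shift ^ m` sends it to degree `i + m`. -/
theorem act_zero_shift_pow {i : ZMod n} {v : W.carrier}
    (h : ∀ j, act W j 0 v = if j = i then v else 0)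
    (m : ℕ) (j : ZMod n) :
    act W j 0 ((shift W ^ m) v) = if j = i + m then (shift W ^ m) v else 0 := by
  induction m generalizing j with
  | zero => simp [h]
  | succ m ih =>
    rw [pow_succ', Module.End.mul_apply, ← sub_add_cancel j 1, act_zero_shift, ih]
    have : j - 1 = i + m ↔ j - 1 + 1 = i + (m + 1 : ℕ) := by
      rw [Nat.cast_succ, ← add_assoc, add_left_inj]
    simp only [this]
    split_ifs <;> simp

variable {W} in
theorem act_zero_eq_ite {i : ZMod n} {v : W.carrier} (h : act W i 0 v = v) (j : ZMod n) :
    act W j 0 v = if j = i then v else 0 := by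
  conv_lhs => rw [← h]
  rw [act_act]
  simp [h]

/-! The comodules `V(i, l)`. -/

variable (q)

/-- The basis vector `v_m` of `V(i, l)`, with the convention `v_m = 0` for `m > l`. -/
def vec (i : ZMod n) (l m : ℕ) : (V q i l).carrier :=
  if h : m < l + 1 then (Finsupp.single ⟨m, h⟩ (1 : 𝕜) : Fin (l + 1) →₀ 𝕜) else 0

theorem vec_eq_zero {i : ZMod n} {l m : ℕ} (h : l < m) : vec q i l m = 0 :=
  dif_neg (by omega)

theorem vec_eq_single (i : ZMod n) (l : ℕ) (m : Fin (l + 1)) :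
    vec q i l m = (Finsupp.single m (1 : 𝕜) : Fin (l + 1) →₀ 𝕜) :=
  dif_pos m.2

theorem V_hom_ext {i : ZMod n} {l : ℕ} {f g : (V q i l).carrier →ₗ[𝕜] M}
    (h : ∀ m ≤ l, f (vec q i l m) = g (vec q i l m)) : f = g := by
  refine Finsupp.lhom_ext' (M := 𝕜) (N := M) (α := Fin (l + 1)) fun m => LinearMap.ext_ring ?_
  have := h m (by omega)
  rw [vec_eq_single] at this
  exact this

/-- The bound `R` is arbitrary beyond `l`, the surplus terms being zero by the convention on `vec`.
This lets two strings of different lengths share one range of summation. -/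
theorem coact_vec (i : ZMod n) (l m : ℕ) {R : ℕ} (hR : l < R) : (V q i l).coact (vec q i l m) =
    ∑ r ∈ range R, vec q i l (m + r) ⊗ₜ[𝕜] path q (i + m) r := by
  by_cases hm : m < l + 1
  · rw [show vec q i l m = _ from vec_eq_single q i l ⟨m, hm⟩]
    refine (stringCoact_single q i l ⟨m, hm⟩).trans ?_
    refine Finset.sum_bij_ne_zero (fun j _ _ => (j : ℕ) - m) ?_ ?_ ?_ ?_
    · intro j _ _
      have := j.2
      simp only [Finset.mem_range]
      omega
    · intro j hj _ j' hj' _ h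
      have h1 : m ≤ j := by simpa [Fin.le_def] using hj
      have h2 : m ≤ j' := by simpa [Fin.le_def] using hj'
      exact Fin.ext (by omega)
    · intro r _ hr
      have hl : m + r < l + 1 := by
        by_contra hl
        rw [vec_eq_zero q (by omega), TensorProduct.zero_tmul] at hr
        exact hr rfl
      have e : vec q i l (m + r) = (Finsupp.single ⟨m + r, hl⟩ (1 : 𝕜) : Fin (l + 1) →₀ 𝕜) :=
        dif_pos hl
      refine ⟨⟨m + r, hl⟩, by simp [Fin.le_def], ?_, by simp⟩
      rw [e] at hr
      dsimp only
      rw [Nat.add_sub_cancel_left]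
      exact hr
    · intro j hj _
      have h1 : m ≤ j := by simpa [Fin.le_def] using hj
      have e : vec q i l (m + (j - m)) = (Finsupp.single j (1 : 𝕜) : Fin (l + 1) →₀ 𝕜) := by
        rw [Nat.add_sub_cancel' h1]
        exact dif_pos j.2
      rw [e]
      rfl
  · rw [vec_eq_zero q (by omega), map_zero, Finset.sum_eq_zero]
    intro r _
    rw [vec_eq_zero q (by omega), TensorProduct.zero_tmul]

theorem act_vec (i : ZMod n) (l m : ℕ) (j : ZMod n) (r : ℕ) : act (V q i l) j r (vec q i l m) =
    if j = i + m then vec q i l (m + r) else 0 := by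
  rw [act_apply, coact_vec q i l m (R := l + 1 + r + 1) (by omega), map_sum]
  simp only [coeff_tmul_path]
  rw [Finset.sum_eq_single r]
  · simp [eq_comm]
  · intro b _ hb
    simp [hb]
  · simp

theorem shift_vec (i : ZMod n) (l m : ℕ) :
    shift (V q i l) (vec q i l m) = vec q i l (m + 1) := by
  simp [shift, act_vec]

theorem shift_pow_vec (i : ZMod n) (l m r : ℕ) :
    (shift (V q i l) ^ r) (vec q i l m) = vec q i l (m + r) := by
  induction r with
  | zero => simp
  | succ r ih => rw [pow_succ', Module.End.mul_apply, ih, shift_vec, add_assoc]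

variable {W} in
/-- The linear map out of `V(i, l)` with `v_m ↦ shift ^ m g`. -/
def stringHom (i : ZMod n) (l : ℕ) (g : W.carrier) : (V q i l).carrier →ₗ[𝕜] W.carrier :=
  Finsupp.linearCombination 𝕜 fun m : Fin (l + 1) => (shift W ^ (m : ℕ)) g

theorem stringHom_vec {i : ZMod n} {l : ℕ} {g : W.carrier} {m : ℕ} (hm : m ≤ l) :
    stringHom q i l g (vec q i l m) = (shift W ^ m) g := by
  rw [show vec q i l m = _ from vec_eq_single q i l ⟨m, by omega⟩]
  exact (Finsupp.linearCombination_single 𝕜 (1 : 𝕜) (⟨m, by omega⟩ : Fin (l + 1))).trans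
    (one_smul _ _)

/-- The only relation of V(i, l) on its generator is that it dies after l + 1 shifts. Injectivity is
not required here; it comes later from the dimension count. -/
theorem isHom_stringHom {i : ZMod n} {l : ℕ} {g : W.carrier} (hg : act W i 0 g = g)
    (hl : (shift W ^ (l + 1)) g = 0) : IsHom (V q i l) W (stringHom q i l g) := by
  refine isHom_of_shift (fun j v => ?_) fun v => ?_
  · refine LinearMap.congr_fun (f := stringHom q i l g ∘ₗ act (V q i l) j 0)
      (g := act W j 0 ∘ₗ stringHom q i l g) (V_hom_ext q fun m hm => ?_) v
    rw [LinearMap.comp_apply, LinearMap.comp_apply, act_vec, stringHom_vec q W hm,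
      act_zero_shift_pow (act_zero_eq_ite hg)]
    split_ifs
    · exact stringHom_vec q W hm
    · exact map_zero _
  · refine LinearMap.congr_fun (f := stringHom q i l g ∘ₗ shift (V q i l))
      (g := shift W ∘ₗ stringHom q i l g) (V_hom_ext q fun m hm => ?_) v
    rw [LinearMap.comp_apply, LinearMap.comp_apply, shift_vec, stringHom_vec q W hm,
      ← Module.End.mul_apply, ← pow_succ']
    rcases hm.lt_or_eq with h | rfl
    · exact stringHom_vec q W h
    · rw [vec_eq_zero q (by omega), hl, map_zero]

theorem finrank_V (i : ZMod n) (l : ℕ) : Module.finrank 𝕜 (V q i l).carrier = l + 1 :=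
  (Module.finrank_finsupp_self (R := 𝕜) (ι := Fin (l + 1))).trans (Fintype.card_fin _)

end

end CyclicPath

/-! ### A determinant of Gaussian binomials -/

section QBinomial

variable {R : Type*} [CommRing R]

/-- The Gaussian binomial "`m` choose `k`" at `q`. -/
def qChoose (q : R) : ℕ → ℕ → R
  | _, 0 => 1
  | 0, _ + 1 => 0
  | m + 1, k + 1 => qChoose q m k + q ^ (k + 1) * qChoose q m (k + 1)

@[simp] theorem qChoose_zero_right (q : R) (m : ℕ) : qChoose q m 0 = 1 := by
  cases m <;> rw [qChoose]

theorem qChoose_succ (q : R) (m k : ℕ) : qChoose q (m + 1) (k + 1) =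
    qChoose q m k + q ^ (k + 1) * qChoose q m (k + 1) := by
  rw [qChoose]

theorem qChoose_eq_zero (q : R) {m k : ℕ} (h : m < k) : qChoose q m k = 0 := by
  induction m generalizing k with
  | zero =>
    obtain ⟨k, rfl⟩ := Nat.exists_eq_succ_of_ne_zero (by omega : k ≠ 0)
    rw [Nat.succ_eq_add_one, qChoose]
  | succ m ih =>
    obtain ⟨k, rfl⟩ := Nat.exists_eq_succ_of_ne_zero (by omega : k ≠ 0)
    rw [Nat.succ_eq_add_one, qChoose_succ, ih (by omega), ih (by omega), mul_zero, add_zero]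

theorem qChoose_self (q : R) (m : ℕ) : qChoose q m m = 1 := by
  induction m with
  | zero => simp
  | succ m ih => rw [qChoose_succ, ih, qChoose_eq_zero q (by omega), mul_zero, add_zero]

theorem qChoose_add (q : R) (k m : ℕ) : qChoose q (k + m) k = qBinom q k m := by
  induction k generalizing m with
  | zero => simp [qBinom_zero_left]
  | succ k ihk =>
    induction m with
    | zero => rw [add_zero, qChoose_self, qBinom_zero_right]
    | succ m ihm =>
      rw [qBinom_succ, ← ihk, ← ihm, show k + 1 + (m + 1) = k + (m + 1) + 1 by ring, qChoose_succ,
        show k + (m + 1) = k + 1 + m by ring]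

theorem qFact_mul_qChoose (q : R) {m k : ℕ} (h : k ≤ m) :
    qFact q k * qFact q (m - k) * qChoose q m k = qFact q m := by
  obtain ⟨r, rfl⟩ := Nat.exists_eq_add_of_le h
  rw [Nat.add_sub_cancel_left, qChoose_add, qFact_mul_qFact_mul_qBinom]

theorem map_qChoose {S : Type*} [CommRing S] (φ : R →+* S) (q : R) (m k : ℕ) :
    φ (qChoose q m k) = qChoose (φ q) m k := by
  induction m generalizing k with
  | zero => cases k <;> simp [qChoose]
  | succ m ih => cases k <;> simp [qChoose, ih]

theorem qNum_add (q : R) (l m : ℕ) : qNum q (l + m) = qNum q l + q ^ l * qNum q m := by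
  rw [qNum, qNum, qNum, Finset.sum_range_add, Finset.mul_sum]
  simp only [pow_add]

theorem qFact_succ (q : R) (m : ℕ) : qFact q (m + 1) = qFact q m * qNum q (m + 1) := by
  simp [qFact, Finset.prod_range_succ]

/-- The `q`-analogue of the falling factorial, up to a power of `q`. -/
def qFalling (q : R) (m j : ℕ) : R := ∏ l ∈ range j, (qNum q m - qNum q l)

theorem qFact_mul_qFalling (q : R) {m j : ℕ} (h : j ≤ m) :
    qFact q (m - j) * qFalling q m j = q ^ (∑ l ∈ range j, l) * qFact q m := by
  induction j with
  | zero => simp [qFalling]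
  | succ j ih =>
    have ih := ih (by omega)
    have e1 : qFact q (m - j) = qFact q (m - (j + 1)) * qNum q (m - j) := by
      rw [show m - j = m - (j + 1) + 1 by omega, qFact_succ]
    have e2 : qNum q m = qNum q j + q ^ j * qNum q (m - j) := by
      rw [← qNum_add, Nat.add_sub_cancel' (by omega)]
    have e3 : qFalling q m (j + 1) = qFalling q m j * (qNum q m - qNum q j) :=
      Finset.prod_range_succ _ _
    rw [Finset.sum_range_succ, pow_add, e3, e2]
    rw [e1] at ih
    linear_combination q ^ j * ih

/-- After scaling rows and columns by q-factorials, entry (i, j) becomes the value at `qNum q (B +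
i)` of a monic polynomial of degree j that does not depend on i. If j exceeds B + i, both sides
vanish. -/
theorem qFact_mul_qFact_mul_qChoose_eq_qFalling (q : R) (A B i j : ℕ) :
    qFact q (B + i) * (qFact q (A + j) * q ^ (∑ l ∈ range j, l) *
      qChoose q (A + B + i) (A + j)) = qFact q (A + B + i) * qFalling q (B + i) j := by
  by_cases h : j ≤ B + i
  · have e1 := qFact_mul_qChoose q (show A + j ≤ A + B + i by omega)
    rw [show A + B + i - (A + j) = B + i - j by omega] at e1
    rw [← e1]
    linear_combination (-qFact q (A + j) * qChoose q (A + B + i) (A + j)) *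
      qFact_mul_qFalling q h
  · rw [qChoose_eq_zero q (by omega), qFalling,
      Finset.prod_eq_zero (Finset.mem_range.2 (by omega : B + i < j)) (sub_self _)]
    simp

/-- A matrix of Gaussian binomials. -/
def qMatrix (q : R) (A B s : ℕ) : Matrix (Fin s) (Fin s) R :=
  Matrix.of fun i j => qChoose q (A + B + i) (A + j)

open Polynomial in
-- Monic polynomials of degrees 0, …, s - 1 differ from the monomials by a unitriangular change of
-- basis.
theorem det_qFalling (v : ℕ → R) (u : ℕ → R) (s : ℕ) :
    (Matrix.of fun i j : Fin s => ∏ l ∈ range j, (v i - u l)).det =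
      (Matrix.vandermonde fun i : Fin s => v i).det := by
  rcases subsingleton_or_nontrivial R with h | h
  · exact Subsingleton.elim _ _
  have hdeg (j : ℕ) : (∏ l ∈ range j, (X - C (u l))).natDegree = j := by
    simp [natDegree_prod_of_monic _ _ fun l _ => monic_X_sub_C (u l)]
  have := Matrix.det_eval_matrixOfPolynomials_eq_det_vandermonde (fun i : Fin s => v i)
    (fun j : Fin s => ∏ l ∈ range j, (X - C (u l))) (fun j => hdeg j)
    (fun j => monic_prod_of_monic _ _ fun l _ => monic_X_sub_C (u l))
  rw [this]
  congr 1
  ext i j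
  simp [eval_prod]

theorem qFact_mul_det_qMatrix (q : R) (A B s : ℕ) :
    (∏ i ∈ range s, qFact q (B + i)) * ((∏ j ∈ range s, qFact q (A + j) * q ^ (∑ l ∈ range j, l)) *
      (qMatrix q A B s).det) = (∏ i ∈ range s, qFact q (A + B + i)) *
      (Matrix.vandermonde fun i : Fin s => qNum q (B + i)).det := by
  rw [← det_qFalling (fun i => qNum q (B + i)) (qNum q)]
  rw [Finset.prod_range, Finset.prod_range, Finset.prod_range, ← Matrix.det_mul_row,
    ← Matrix.det_mul_column, ← Matrix.det_mul_column]
  congr 1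
  ext i j
  simpa [qMatrix, qFalling] using qFact_mul_qFact_mul_qChoose_eq_qFalling q A B i j

/-- Since `qNum q (B + i)` is `qNum q B` plus q^B times `qNum q i`, passing from `i` to `B + i`
multiplies each difference by q^B. -/
theorem det_vandermonde_qNum_add (q : R) (B s : ℕ) : ∃ c : ℕ,
    (Matrix.vandermonde fun i : Fin s => qNum q (B + i)).det =
      q ^ c * (Matrix.vandermonde fun i : Fin s => qNum q (0 + i)).det := by
  refine ⟨∑ i : Fin s, ∑ j ∈ Finset.Ioi i, B, ?_⟩
  simp only [Matrix.det_vandermonde, ← Finset.prod_pow_eq_pow_sum, ← Finset.prod_mul_distrib]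
  refine Finset.prod_congr rfl fun i _ => Finset.prod_congr rfl fun j _ => ?_
  rw [qNum_add, qNum_add, zero_add, zero_add]
  ring

theorem det_qMatrix_zero (q : R) (s : ℕ) : (qMatrix q 0 0 s).det = 1 := by
  rw [Matrix.det_of_isLowerTriangular]
  · simp [qMatrix, qChoose_self]
  · intro i j h
    have h : (i : ℕ) < j := h
    exact qChoose_eq_zero q (by omega)

theorem det_qMatrix_mul [IsDomain R] (q : R) (hq : q ≠ 0) (h : ∀ m, qFact q m ≠ 0) (A B s : ℕ) :
    ∃ c : ℕ, (∏ i ∈ range s, qFact q (A + i) * qFact q (B + i)) * (qMatrix q A B s).det =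
      q ^ c * ∏ i ∈ range s, qFact q (A + B + i) * qFact q i := by
  obtain ⟨c, hc⟩ := det_vandermonde_qNum_add q B s
  have h1 := qFact_mul_det_qMatrix q A B s
  -- For A = B = 0 the matrix is unitriangular. This evaluates the remaining Vandermonde determinant
  -- without computing its factors.
  have h0 := qFact_mul_det_qMatrix q 0 0 s
  rw [hc] at h1
  simp only [det_qMatrix_zero, add_zero, zero_add, mul_one] at h0
  have h0' := mul_left_cancel₀ (Finset.prod_ne_zero_iff.2 fun i _ => h i) h0
  have e : (fun i : Fin s => qNum q (0 + (i : ℕ))) = fun i : Fin s => qNum q i := by simp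
  rw [e, ← h0'] at h1
  refine ⟨c, ?_⟩
  simp only [Finset.prod_mul_distrib] at h1 ⊢
  refine mul_left_cancel₀ (Finset.prod_ne_zero_iff.2 fun j (_ : j ∈ range s) =>
    pow_ne_zero (∑ l ∈ range j, l) hq) ?_
  linear_combination h1

end QBinomial

/-! ### Multiplicity of a primitive root of unity in q-factorials -/

section Valuation

open Polynomial

variable {K : Type*} [Field K] [CharZero K]

theorem qNum_X_mul {K : Type*} [Field K] (m : ℕ) : qNum (X : K[X]) m * (X - 1) = X ^ m - 1 :=
  geom_sum_mul _ _

theorem qNum_X_ne_zero {m : ℕ} (hm : m ≠ 0) : qNum (X : K[X]) m ≠ 0 := by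
  intro h
  have := congrArg (eval 1) h
  simp [qNum, eval_finsetSum, hm] at this

theorem qFact_X_ne_zero (m : ℕ) : qFact (X : K[X]) m ≠ 0 :=
  Finset.prod_ne_zero_iff.2 fun _ _ => qNum_X_ne_zero (Nat.succ_ne_zero _)

variable {ζ : K} {d : ℕ}

/-- The polynomial divides X^m - 1, which is separable in characteristic 0, so roots are simple. As
ζ ≠ 1, the quotient by X - 1 keeps the root ζ. -/
theorem rootMultiplicity_qNum (hζ : IsPrimitiveRoot ζ d) (hd : 2 ≤ d) {m : ℕ} (hm : m ≠ 0) :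
    rootMultiplicity ζ (qNum (X : K[X]) m) = if d ∣ m then 1 else 0 := by
  have h1 : ζ ≠ 1 := hζ.ne_one (by omega)
  have hev : eval ζ (qNum (X : K[X]) m) * (ζ - 1) = ζ ^ m - 1 := by
    simpa using congrArg (eval ζ) (qNum_X_mul (K := K) m)
  have hsep : (qNum (X : K[X]) m).Separable := by
    have hm' : (m : K) ≠ 0 := Nat.cast_ne_zero.2 hm
    exact Separable.of_dvd (X_pow_sub_one_separable_iff.2 hm')
      (Dvd.intro _ (qNum_X_mul (K := K) m))
  split_ifs with h
  · refine le_antisymm (rootMultiplicity_le_one_of_separable hsep ζ) ?_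
    refine (rootMultiplicity_pos (qNum_X_ne_zero hm)).2 ?_
    rw [(hζ.pow_eq_one_iff_dvd m).2 h, sub_self] at hev
    exact (mul_eq_zero.1 hev).resolve_right (sub_ne_zero.2 h1)
  · refine rootMultiplicity_eq_zero fun h2 => h ?_
    rw [IsRoot.def] at h2
    rw [h2, zero_mul, eq_comm, sub_eq_zero] at hev
    exact (hζ.pow_eq_one_iff_dvd m).1 hev

theorem rootMultiplicity_qFact (hζ : IsPrimitiveRoot ζ d) (hd : 2 ≤ d) (m : ℕ) :
    rootMultiplicity ζ (qFact (X : K[X]) m) = m / d := by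
  induction m with
  | zero => simp [qFact]
  | succ m ih =>
    rw [qFact_succ, rootMultiplicity_mul, ih, rootMultiplicity_qNum hζ hd (Nat.succ_ne_zero m),
      Nat.succ_div]
    exact mul_ne_zero (qFact_X_ne_zero m) (qNum_X_ne_zero (Nat.succ_ne_zero m))

theorem rootMultiplicity_prod_range (F : ℕ → K[X]) (hF : ∀ i, F i ≠ 0) (s : ℕ) :
    rootMultiplicity ζ (∏ i ∈ range s, F i) = ∑ i ∈ range s, rootMultiplicity ζ (F i) := by
  induction s with
  | zero => simp
  | succ s ih =>
    rw [Finset.prod_range_succ, Finset.sum_range_succ, rootMultiplicity_mul, ih]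
    exact mul_ne_zero (Finset.prod_ne_zero_iff.2 fun i _ => hF i) (hF s)

/-- A criterion for the nonvanishing of a determinant of Gaussian binomials at a root of unity. -/
theorem det_qMatrix_ne_zero (hζ : IsPrimitiveRoot ζ d) (hd : 2 ≤ d) {A B s : ℕ}
    (h : ∑ i ∈ range s, ((A + i) / d + (B + i) / d) = ∑ i ∈ range s, ((A + B + i) / d + i / d)) :
    (qMatrix ζ A B s).det ≠ 0 := by
  obtain ⟨c, hc⟩ := det_qMatrix_mul (X : K[X]) X_ne_zero qFact_X_ne_zero A B s
  have hne (i j : ℕ) : qFact (X : K[X]) i * qFact (X : K[X]) j ≠ 0 :=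
    mul_ne_zero (qFact_X_ne_zero i) (qFact_X_ne_zero j)
  have hr : (X : K[X]) ^ c * ∏ i ∈ range s, qFact (X : K[X]) (A + B + i) * qFact X i ≠ 0 :=
    mul_ne_zero (pow_ne_zero _ X_ne_zero) (Finset.prod_ne_zero_iff.2 fun i _ => hne _ _)
  have hX : rootMultiplicity ζ ((X : K[X]) ^ c) = 0 := by
    refine rootMultiplicity_eq_zero ?_
    simp [IsRoot.def, hζ.ne_zero (by omega)]
  have hdet : (qMatrix (X : K[X]) A B s).det ≠ 0 := by
    intro h0
    rw [h0, mul_zero] at hc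
    exact hr hc.symm
  -- The power of X contributes nothing because ζ is nonzero, and the q-factorials contribute the
  -- two floor sums of `h`. These cancel, leaving multiplicity zero for the determinant.
  have hv := congrArg (rootMultiplicity ζ) hc
  rw [rootMultiplicity_mul (by rwa [hc]), rootMultiplicity_mul hr, hX,
    rootMultiplicity_prod_range _ fun i => hne _ _,
    rootMultiplicity_prod_range _ fun i => hne _ _] at hv
  simp only [rootMultiplicity_mul (hne _ _), rootMultiplicity_qFact hζ hd] at hv
  have h0 : rootMultiplicity ζ (qMatrix (X : K[X]) A B s).det = 0 := by omega
  have hev : eval ζ (qMatrix (X : K[X]) A B s).det ≠ 0 := by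
    intro h1
    have := (rootMultiplicity_pos hdet).2 h1
    omega
  have e : eval ζ (qMatrix (X : K[X]) A B s).det = (qMatrix ζ A B s).det := by
    rw [← coe_evalRingHom, RingHom.map_det]
    congr 1
    ext i j
    rw [RingHom.mapMatrix_apply, Matrix.map_apply, qMatrix, Matrix.of_apply, map_qChoose,
      coe_evalRingHom, eval_X]
    rfl
  rwa [← e]

theorem det_qMatrix_one_ne_zero (A B s : ℕ) : (qMatrix (1 : K) A B s).det ≠ 0 := by
  have hf (m : ℕ) : qFact (1 : K) m ≠ 0 := by
    refine Finset.prod_ne_zero_iff.2 fun i _ => ?_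
    simp only [qNum, one_pow, Finset.sum_const, Finset.card_range, nsmul_eq_mul, mul_one]
    exact_mod_cast Nat.succ_ne_zero i
  obtain ⟨c, hc⟩ := det_qMatrix_mul (1 : K) one_ne_zero hf A B s
  intro h0
  rw [h0, mul_zero, one_pow, one_mul, eq_comm] at hc
  exact Finset.prod_ne_zero_iff.2 (fun i _ => mul_ne_zero (hf _) (hf _)) hc

end Valuation

/-! ### Sums of floors: when the determinant criterion holds -/

section FloorSums

variable {d : ℕ}

theorem sum_range_div_period (hd : 0 < d) (A : ℕ) : ∑ i ∈ range d, (A + i) / d = A := by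
  induction A with
  | zero =>
    refine Finset.sum_eq_zero fun i hi => ?_
    rw [zero_add, Nat.div_eq_of_lt (Finset.mem_range.1 hi)]
  | succ A ih =>
    have h1 := Finset.sum_range_succ (fun i => (A + i) / d) d
    have h2 := Finset.sum_range_succ' (fun i => (A + i) / d) d
    simp only [Nat.add_div_right A hd, add_zero] at h1 h2
    simp only [show ∀ i, A + 1 + i = A + (i + 1) by intro i; ring]
    omega

theorem sum_range_div_add_mul (hd : 0 < d) (A k i : ℕ) :
    ∑ x ∈ range (k * d + i), (A + x) / d =
      k * A + d * (∑ x ∈ range k, x) + k * i + ∑ x ∈ range i, (A + x) / d := by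
  have h1 : ∑ x ∈ range (k * d), (A + x) / d = k * A + d * ∑ x ∈ range k, x := by
    induction k with
    | zero => simp
    | succ k ih =>
      rw [add_mul, one_mul, Finset.sum_range_add, ih, Finset.sum_range_succ]
      simp only [← add_assoc]
      rw [sum_range_div_period hd]
      ring
  rw [Finset.sum_range_add, h1]
  simp only [show ∀ x, A + (k * d + x) = A + x + d * k by intro x; ring,
    Nat.add_mul_div_left _ _ hd, Finset.sum_add_distrib]
  simp
  ring

/-- By Hermite's identity a full period of floors starting at A sums to A, which is additive in A.
Full periods therefore contribute equally to both sides, and only the residue i matters. -/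
theorem sum_range_div_add_mul_iff (hd : 0 < d) (A B k i : ℕ) :
    ∑ x ∈ range (k * d + i), ((A + x) / d + (B + x) / d) =
      ∑ x ∈ range (k * d + i), ((A + B + x) / d + x / d) ↔
    ∑ x ∈ range i, ((A + x) / d + (B + x) / d) = ∑ x ∈ range i, ((A + B + x) / d + x / d) := by
  have h0 := sum_range_div_add_mul hd 0 k i
  simp only [zero_add] at h0
  simp only [Finset.sum_add_distrib, sum_range_div_add_mul hd A, sum_range_div_add_mul hd B,
    sum_range_div_add_mul hd (A + B), h0, mul_add]
  omega

/-- The floor equals α for the first c values of x and α + 1 for the other i - c; the bound i ≤ d +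
c excludes a second jump. -/
theorem sum_range_div_step {α c i : ℕ} (hc : c ≤ d) (hi : c ≤ i) (hid : i ≤ d + c) :
    ∑ x ∈ range i, (α * d + (d - c) + x) / d = α * i + (i - c) := by
  have key (r x : ℕ) (h1 : r * d ≤ x) (h2 : x < (r + 1) * d) : x / d = r :=
    Nat.div_eq_of_lt_le h1 h2
  obtain ⟨t, rfl⟩ := Nat.exists_eq_add_of_le hi
  have h1 : ∑ x ∈ range c, (α * d + (d - c) + x) / d = ∑ _x ∈ range c, α := by
    refine Finset.sum_congr rfl fun x hx => ?_
    have := Finset.mem_range.1 hx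
    refine key _ _ ?_ ?_
    · omega
    · rw [add_mul]; omega
  have h2 : ∑ x ∈ range t, (α * d + (d - c) + (c + x)) / d = ∑ _x ∈ range t, (α + 1) := by
    refine Finset.sum_congr rfl fun x hx => ?_
    have := Finset.mem_range.1 hx
    refine key _ _ ?_ ?_
    · rw [add_mul]; omega
    · rw [add_mul, add_mul]; omega
  rw [Finset.sum_range_add, h1, h2]
  simp only [Finset.sum_const, Finset.card_range, smul_eq_mul, Nat.add_sub_cancel_left]
  ring

/-- No carry occurs in any term, so the two sides agree term by term. -/
theorem sum_range_div_low (hd : 0 < d) {α β a b k i : ℕ} (hid : i ≤ d) (h : a + b + i ≤ d) :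
    ∑ x ∈ range (k * d + i), ((α * d + a + x) / d + (β * d + b + x) / d) =
      ∑ x ∈ range (k * d + i), ((α * d + a + (β * d + b) + x) / d + x / d) := by
  rw [sum_range_div_add_mul_iff hd]
  refine Finset.sum_congr rfl fun x hx => ?_
  have hx := Finset.mem_range.1 hx
  have key (r y : ℕ) (hy : y < d) : (r * d + y) / d = r := by
    rw [mul_comm, Nat.mul_add_div hd, Nat.div_eq_of_lt hy, add_zero]
  rw [add_assoc, key _ _ (by omega), add_assoc, key _ _ (by omega),
    show α * d + a + (β * d + b) + x = (α + β) * d + (a + b + x) by ring, key _ _ (by omega),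
    Nat.div_eq_of_lt (by omega), add_zero]

/-- The two sides agree only in total. The jumps contribute a and b on the left; on the right the
quotient is α + β + 1 and the jump contributes a + b - i. -/
theorem sum_range_div_high (hd : 0 < d) {α β a b k i : ℕ} (hid : i ≤ d) (ha : a ≤ i) (hb : b ≤ i)
    (hab : i ≤ a + b) :
    ∑ x ∈ range (k * d + i), ((α * d + (d - (i - a)) + x) / d + (β * d + (d - (i - b)) + x) / d) =
      ∑ x ∈ range (k * d + i),
        ((α * d + (d - (i - a)) + (β * d + (d - (i - b))) + x) / d + x / d) := by
  rw [sum_range_div_add_mul_iff hd, Finset.sum_add_distrib, Finset.sum_add_distrib,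
    sum_range_div_step (by omega) (by omega) (by omega),
    sum_range_div_step (by omega) (by omega) (by omega)]
  have e : α * d + (d - (i - a)) + (β * d + (d - (i - b))) =
      (α + β + 1) * d + (d - (2 * i - a - b)) := by
    rw [add_mul, add_mul]; omega
  rw [e, sum_range_div_step (by omega) (by omega) (by omega),
    Finset.sum_eq_zero fun x hx => Nat.div_eq_of_lt (lt_of_lt_of_le (Finset.mem_range.1 hx) hid)]
  rw [add_mul, add_mul]
  omega

end FloorSums

/-! ### The operator x + y on a truncated quantum plane -/

section Grid

variable {K M : Type*} [Field K] [AddCommGroup M] [Module K M]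

/-- A family `b` on which `T` acts as multiplication by `x + y` does on the monomials
`x ^ i * y ^ j` of a quantum plane. -/
def IsGrid (q : K) (T : Module.End K M) (b : ℕ → ℕ → M) : Prop :=
  ∀ i j, T (b i j) = b (i + 1) j + q ^ i • b i (j + 1)

/-- The span of the `b i j` with `i + j + 1 = s`. -/
def gridBelow (K : Type*) {M : Type*} [Field K] [AddCommGroup M] [Module K M] (b : ℕ → ℕ → M)
    (s : ℕ) : Submodule K M :=
  Submodule.span K {x | ∃ i j, i + j + 1 = s ∧ x = b i j}

/-- The elements that agree with a nonzero multiple of `b 0 s` up to the image under `T` of the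
span of the `b i j` with `i + j + 1 = s`. -/
def GridLead (T : Module.End K M) (b : ℕ → ℕ → M) (s : ℕ) (x : M) : Prop :=
  ∃ c : K, c ≠ 0 ∧ ∃ w ∈ gridBelow K b s, x = c • b 0 s + T w

variable {q : K} {T : Module.End K M} {b : ℕ → ℕ → M}

theorem mem_gridBelow {i j s : ℕ} (h : i + j + 1 = s) : b i j ∈ gridBelow K b s :=
  Submodule.subset_span ⟨i, j, h, rfl⟩

theorem GridLead.add {s : ℕ} {x w : M} (hx : GridLead T b s x) (hw : w ∈ gridBelow K b s) :
    GridLead T b s (x + T w) := by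
  obtain ⟨c, hc, w', hw', rfl⟩ := hx
  exact ⟨c, hc, w' + w, Submodule.add_mem _ hw' hw, by rw [map_add, add_assoc]⟩

theorem gridLead_self (s : ℕ) : GridLead T b s (b 0 s) :=
  ⟨1, one_ne_zero, 0, Submodule.zero_mem _, by simp⟩

namespace IsGrid

/-- The factor q^(i j') absorbs the commutation of x^i past y^j', so results at the origin transfer
to any starting point. -/
theorem shift (h : IsGrid q T b) (i j : ℕ) :
    IsGrid q T fun i' j' => q ^ (i * j') • b (i + i') (j + j') := by
  intro i' j'
  rw [map_smul, h, smul_add, smul_smul, smul_smul, ← pow_add, ← pow_add, add_assoc i i' 1,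
    add_assoc j j' 1]
  congr 3
  ring

/-- The q-binomial theorem for (x + y)^r with yx = qxy. -/
theorem pow_apply_zero_zero (h : IsGrid q T b) (r : ℕ) :
    (T ^ r) (b 0 0) = ∑ x ∈ antidiagonal r, qChoose q r x.1 • b x.1 x.2 := by
  induction r with
  | zero => simp
  | succ r ih =>
    have e (F : ℕ × ℕ → M) : ∑ x ∈ antidiagonal (r + 1), F x =
        F (0, r + 1) + ∑ x ∈ antidiagonal r, F (x.1 + 1, x.2) :=
      Finset.Nat.sum_antidiagonal_succ
    have e' (F : ℕ × ℕ → M) : ∑ x ∈ antidiagonal (r + 1), F x =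
        F (r + 1, 0) + ∑ x ∈ antidiagonal r, F (x.1, x.2 + 1) :=
      Finset.Nat.sum_antidiagonal_succ'
    have e1 := e fun x => (q ^ x.1 * qChoose q r x.1) • b x.1 x.2
    have e2 := e' fun x => (q ^ x.1 * qChoose q r x.1) • b x.1 x.2
    rw [pow_succ', Module.End.mul_apply, ih, map_sum]
    simp only [map_smul, h _ _, smul_add, Finset.sum_add_distrib]
    rw [e fun x => qChoose q (r + 1) x.1 • b x.1 x.2]
    simp only [qChoose_succ, qChoose_zero_right, add_smul, Finset.sum_add_distrib, pow_zero,
      one_smul, mul_one, smul_smul, qChoose_eq_zero q (Nat.lt_succ_self r), mul_zero, zero_smul,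
      zero_add] at e1 e2 ⊢
    simp only [mul_comm (qChoose q r _) (q ^ _)]
    rw [← e2, e1]
    abel

theorem pow_apply_zero (h : IsGrid q T b) (j r : ℕ) :
    (T ^ r) (b 0 j) = ∑ x ∈ antidiagonal r, qChoose q r x.1 • b x.1 (j + x.2) := by
  simpa using (h.shift 0 j).pow_apply_zero_zero r

theorem map_gridBelow (h : IsGrid q T b) {s : ℕ} {x : M} (hx : x ∈ gridBelow K b s) :
    T x ∈ gridBelow K b (s + 1) := by
  have : gridBelow K b s ≤ (gridBelow K b (s + 1)).comap T := by
    refine Submodule.span_le.2 ?_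
    rintro _ ⟨i, j, hij, rfl⟩
    change T (b i j) ∈ gridBelow K b (s + 1)
    rw [h]
    exact Submodule.add_mem _ (mem_gridBelow (by omega))
      (Submodule.smul_mem _ _ (mem_gridBelow (by omega)))
  exact this hx

theorem pow_mem_gridBelow (h : IsGrid q T b) {i j r s : ℕ} (hs : i + j + r + 1 = s) :
    (T ^ r) (b i j) ∈ gridBelow K b s := by
  induction r generalizing s with
  | zero => exact mem_gridBelow hs
  | succ r ih =>
    rw [pow_succ', Module.End.mul_apply]
    obtain ⟨s, rfl⟩ := Nat.exists_eq_add_of_le' (by omega : 1 ≤ s)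
    exact h.map_gridBelow (ih (by omega))

/-- Modulo the image of T one has b (i+1) j ≡ -q^i b i (j+1), which moves the first index down to 0
at the cost of a nonzero scalar. -/
theorem gridLead (h : IsGrid q T b) (hq : q ≠ 0) (i j : ℕ) : GridLead T b (i + j) (b i j) := by
  induction i generalizing j with
  | zero => rw [zero_add]; exact gridLead_self j
  | succ i ih =>
    obtain ⟨c, hc, w, hw, e⟩ := ih (j + 1)
    rw [show i + 1 + j = i + (j + 1) by ring]
    refine ⟨-(q ^ i * c), neg_ne_zero.2 (mul_ne_zero (pow_ne_zero _ hq) hc), b i j - q ^ i • w,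
      Submodule.sub_mem _ (mem_gridBelow (by ring)) (Submodule.smul_mem _ _ hw), ?_⟩
    have := h i j
    rw [e] at this
    rw [map_sub, map_smul, this, smul_add, smul_smul, neg_smul]
    abel

/-- A `T`-stable subspace that contains, for each `s` less than `α`, an element with leading
part in degree `s`, contains the whole grid. -/
theorem mem_of_gridLead (h : IsGrid q T b) (hq : q ≠ 0) {α : ℕ} (hα : ∀ j, b α j = 0)
    {R : Submodule K M} (hR : ∀ x ∈ R, T x ∈ R) (hL : ∀ s < α, ∃ x ∈ R, GridLead T b s x)
    (i j : ℕ) : b i j ∈ R := by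
  obtain ⟨s, hs⟩ : ∃ s, i + j = s := ⟨_, rfl⟩
  induction s using Nat.strong_induction_on generalizing i j with
  | h s ih =>
    have hb : ∀ w ∈ gridBelow K b s, T w ∈ R := fun w hw => hR w (by
      have : gridBelow K b s ≤ R := by
        refine Submodule.span_le.2 ?_
        rintro _ ⟨i, j, hij, rfl⟩
        exact ih (i + j) (by omega) i j rfl
      exact this hw)
    have key : ∀ x ∈ R, GridLead T b s x → b 0 s ∈ R := by
      rintro x hx ⟨c, hc, w, hw, rfl⟩
      have := R.smul_mem c⁻¹ ((R.add_mem_iff_left (hb w hw)).1 hx)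
      rwa [inv_smul_smul₀ hc] at this
    have h0 : b 0 s ∈ R := by
      rcases lt_or_ge s α with hlt | hle
      · obtain ⟨x, hx, hx'⟩ := hL s hlt
        exact key x hx hx'
      -- Past the truncation, the zero vector `b α (s - α)` itself has leading part in degree s, so
      -- no generator is needed.
      · have := h.gridLead hq α (s - α)
        rw [Nat.add_sub_cancel' hle, hα] at this
        exact key 0 R.zero_mem this
    obtain ⟨c, -, w, hw, e⟩ := h.gridLead hq i j
    rw [hs] at e hw
    rw [e]
    exact R.add_mem (R.smul_mem c h0) (hb w hw)

/-- The result has degree α + β - 1 - s, where only the s monomials with first index in [α - s, α)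
survive the truncation. Terms of the q-binomial expansion outside this window vanish, and so do
coefficients of window terms beyond r. -/
theorem pow_apply_zero_eq_sum (h : IsGrid q T b) {α β : ℕ}
    (h0 : ∀ i j, α ≤ i ∨ β ≤ j → b i j = 0) {s i r : ℕ} (hα : s ≤ α) (hβ : s ≤ β)
    (hr : i + r + 1 + s = α + β) :
    (T ^ r) (b 0 i) =
      ∑ j : Fin s, qChoose q r (α - s + j) • b (α - s + j) (β - 1 - j) := by
  rw [h.pow_apply_zero, Finset.Nat.sum_antidiagonal_eq_sum_range_succ_mk,
    Fin.sum_univ_eq_sum_range (fun j => qChoose q r (α - s + j) • b (α - s + j) (β - 1 - j)) s]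
  have e := Finset.sum_Ico_eq_sum_range (fun c => qChoose q r c • b c (i + r - c)) (α - s) α
  rw [Nat.sub_sub_self hα] at e
  have e' : ∑ j ∈ range s, qChoose q r (α - s + j) • b (α - s + j) (β - 1 - j) =
      ∑ j ∈ range s, qChoose q r (α - s + j) • b (α - s + j) (i + r - (α - s + j)) := by
    refine Finset.sum_congr rfl fun j hj => ?_
    have := Finset.mem_range.1 hj
    rw [show i + r - (α - s + j) = β - 1 - j by omega]
  rw [e', ← e]
  refine Finset.sum_congr_of_eq_on_inter ?_ ?_ ?_
  · intro c hc hc'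
    have := Finset.mem_range.1 hc
    have : ¬ (α - s ≤ c ∧ c < α) := fun h => hc' (Finset.mem_Ico.2 h)
    dsimp only
    rw [h0, smul_zero]
    omega
  · intro c hc hc'
    have : ¬ c < r + 1 := fun h => hc' (Finset.mem_range.2 h)
    rw [qChoose_eq_zero q (by omega), zero_smul]
  · intro c hc hc'
    have := Finset.mem_range.1 hc
    dsimp only
    rw [show i + r - c = i + (r - c) by omega]

/-- If a matrix of Gaussian binomials is invertible, then there is an element with leading part
`b 0 s` that is killed by the expected power of `T`. -/
theorem exists_pow_apply_eq_zero (h : IsGrid q T b) {α β : ℕ}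
    (h0 : ∀ i j, α ≤ i ∨ β ≤ j → b i j = 0) {s : ℕ} (hα : s < α) (hβ : s < β)
    (hdet : (qMatrix q (α - s) (β - s) s).det ≠ 0) :
    ∃ c : Fin s → K, (T ^ (α + β - 1 - 2 * s))
      (b 0 s + ∑ i : Fin s, c i • (T ^ ((i : ℕ) + 1)) (b 0 (s - 1 - i))) = 0 := by
  set Q := qMatrix q (α - s) (β - s) s with hQ
  -- These are minus the coordinates of the image of `b 0 s`. Row i of `Q` holds the coordinates of
  -- the image of the i-th correction, so c Q = t says that the total vanishes.
  set t : Fin s → K := fun j => -qChoose q (α + β - 1 - 2 * s) (α - s + j) with ht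
  refine ⟨Matrix.vecMul t Q⁻¹, ?_⟩
  have hc : Matrix.vecMul (Matrix.vecMul t Q⁻¹) Q = t := by
    rw [Matrix.vecMul_vecMul, Matrix.nonsing_inv_mul _ (isUnit_iff_ne_zero.2 hdet),
      Matrix.vecMul_one]
  generalize Matrix.vecMul t Q⁻¹ = c at hc
  have e (i : Fin s) : (T ^ (α + β - 1 - 2 * s)) ((T ^ ((i : ℕ) + 1)) (b 0 (s - 1 - i))) =
      ∑ j : Fin s, Q i j • b (α - s + j) (β - 1 - j) := by
    have := i.2
    rw [← Module.End.mul_apply, ← pow_add, h.pow_apply_zero_eq_sum h0 hα.le hβ.le (by omega)]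
    rw [show α + β - 1 - 2 * s + (i + 1) = α - s + (β - s) + i by omega]
    rfl
  rw [map_add, map_sum, h.pow_apply_zero_eq_sum h0 hα.le hβ.le (by omega)]
  simp only [map_smul, e, Finset.smul_sum, smul_smul]
  rw [Finset.sum_comm, ← Finset.sum_add_distrib]
  refine Finset.sum_eq_zero fun j _ => ?_
  rw [← Finset.sum_smul, ← add_smul]
  have := congrFun hc j
  simp only [Matrix.vecMul, dotProduct, ht] at this
  rw [this, add_neg_cancel, zero_smul]

theorem exists_gridLead (h : IsGrid q T b) {α β : ℕ}
    (h0 : ∀ i j, α ≤ i ∨ β ≤ j → b i j = 0) {s : ℕ} (hα : s < α) (hβ : s < β)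
    (hdet : (qMatrix q (α - s) (β - s) s).det ≠ 0) :
    ∃ x, GridLead T b s x ∧ (T ^ (α + β - 1 - 2 * s)) x = 0 := by
  obtain ⟨c, hc⟩ := h.exists_pow_apply_eq_zero h0 hα hβ hdet
  refine ⟨_, ?_, hc⟩
  have := (gridLead_self (T := T) (b := b) s).add (w := ∑ i : Fin s, c i •
    (T ^ (i : ℕ)) (b 0 (s - 1 - i))) (Submodule.sum_mem _ fun i _ => Submodule.smul_mem _ _
      (h.pow_mem_gridBelow (by omega)))
  simpa only [map_sum, map_smul, pow_succ', Module.End.mul_apply] using this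

/-! ### The d-th power of the operator at a primitive d-th root of unity -/

section RootOfUnity

variable {d : ℕ}

theorem _root_.qChoose_eq_zero_of_isPrimitiveRoot (hq : IsPrimitiveRoot q d) {c : ℕ} (h0 : 0 < c)
    (hc : c < d) : qChoose q d c = 0 := by
  have h1 : q - 1 ≠ 0 := sub_ne_zero.2 (hq.ne_one (by omega))
  have hn (m : ℕ) : qNum q m * (q - 1) = q ^ m - 1 := geom_sum_mul _ _
  have hf (m : ℕ) (hm : m < d) : qFact q m ≠ 0 := by
    refine Finset.prod_ne_zero_iff.2 fun i hi h2 => ?_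
    have := hn (i + 1)
    rw [h2, zero_mul, eq_comm, sub_eq_zero] at this
    have hi := Finset.mem_range.1 hi
    exact hq.pow_ne_one_of_pos_of_lt (by omega) (by omega) this
  have hd : qFact q d = 0 := by
    refine Finset.prod_eq_zero (Finset.mem_range.2 (by omega : d - 1 < d)) ?_
    have := hn d
    rw [hq.pow_eq_one, sub_self] at this
    rw [show d - 1 + 1 = d by omega]
    exact (mul_eq_zero.1 this).resolve_right h1
  have := qFact_mul_qChoose q hc.le
  rw [hd] at this
  exact (mul_eq_zero.1 this).resolve_left (mul_ne_zero (hf c hc) (hf _ (by omega)))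

/-- The intermediate Gaussian binomials vanish at q, and the commutation factor q^(i d) of the last
term is 1. -/
theorem pow_order_apply (h : IsGrid q T b) (hq : IsPrimitiveRoot q d) (hd : 0 < d) (i j : ℕ) :
    (T ^ d) (b i j) = b (i + d) j + b i (j + d) := by
  have := (h.shift i j).pow_apply_zero_zero d
  obtain ⟨m, rfl⟩ := Nat.exists_eq_add_of_le' (by omega : 1 ≤ d)
  have e (F : ℕ × ℕ → M) : ∑ x ∈ antidiagonal (m + 1), F x =
      F (0, m + 1) + ∑ x ∈ antidiagonal m, F (x.1 + 1, x.2) :=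
    Finset.Nat.sum_antidiagonal_succ
  rw [e, Finset.sum_eq_single (m, 0)] at this
  · simp only [qChoose_self, qChoose_zero_right, mul_zero, pow_zero, add_zero, one_smul,
      mul_comm i (m + 1), pow_mul, hq.pow_eq_one, one_pow] at this
    rw [this, add_comm]
  · rintro ⟨x, y⟩ hx hne
    have hx : x + y = m := by simpa using hx
    have : y ≠ 0 := by
      rintro rfl
      exact hne (Prod.ext hx rfl)
    dsimp only
    rw [qChoose_eq_zero_of_isPrimitiveRoot hq (by omega) (by omega), zero_smul]
  · simp

theorem pow_order (h : IsGrid q T b) (hq : IsPrimitiveRoot q d) (hd : 0 < d) (i j : ℕ) :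
    IsGrid 1 (T ^ d) fun c c' => b (c * d + i) (c' * d + j) := by
  intro c c'
  rw [h.pow_order_apply hq hd, one_pow, one_smul]
  congr 2 <;> ring

/-- An element with leading part in degree `k * d + i` that is killed by a power of `T ^ d`. -/
theorem exists_gridLead_of_dvd [CharZero K] (h : IsGrid q T b) (hq : IsPrimitiveRoot q d)
    (hd : 0 < d) {i j k e m s : ℕ} (h0 : ∀ c c', e ≤ c ∨ m ≤ c' → b (c * d + i) (c' * d + j) = 0)
    (he : k < e) (hm : k < m) (hs : k * d + (i + j) = s) :
    ∃ x, GridLead T b s x ∧ (T ^ ((e + m - 1 - 2 * k) * d)) x = 0 := by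
  obtain ⟨c, hc⟩ := (h.pow_order hq hd i j).exists_pow_apply_eq_zero h0 he hm
    (det_qMatrix_one_ne_zero _ _ _)
  refine ⟨_, ?_, by rwa [mul_comm, pow_mul]⟩
  obtain ⟨m, rfl⟩ := Nat.exists_eq_add_of_le' (by omega : 1 ≤ d)
  have hl := h.gridLead (hq.ne_zero (by omega)) (0 * (m + 1) + i) (k * (m + 1) + j)
  rw [show 0 * (m + 1) + i + (k * (m + 1) + j) = s by omega] at hl
  -- With d written as m + 1, a correction (T^d)^(t+1) is T applied to T^(t d + d - 1). Peeling off
  -- this one T shows that the corrections do not disturb the leading part for T.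
  have := hl.add (w := ∑ t : Fin k, c t • (T ^ ((t : ℕ) * (m + 1) + m))
    (b (0 * (m + 1) + i) ((k - 1 - t) * (m + 1) + j)))
    (Submodule.sum_mem _ fun t _ => Submodule.smul_mem _ _ (h.pow_mem_gridBelow (by
      obtain ⟨u, hu⟩ := Nat.exists_eq_add_of_lt t.2
      have e1 : k - 1 - (t : ℕ) = u := by omega
      have e2 : k * (m + 1) = t * (m + 1) + u * (m + 1) + (m + 1) := by
        conv_lhs => rw [hu]
        ring
      rw [e1]
      omega)))
  refine (congrArg (GridLead T b s) ?_).mp this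
  simp only [map_sum, map_smul, ← pow_mul, ← Module.End.mul_apply, ← pow_succ']
  congr 1
  refine Finset.sum_congr rfl fun t _ => ?_
  rw [show (t : ℕ) * (m + 1) + m + 1 = (m + 1) * (t + 1) by ring]

end RootOfUnity

end IsGrid

end Grid

/-! ### Strings, their indecomposability, and products of two strings -/

namespace CyclicPath

open Comod (IsHom cls)

noncomputable section

variable {𝕜 : Type u} [Field 𝕜] {n : ℕ} [NeZero n] (q : rootsOfUnity n 𝕜)

/-! Indecomposability. -/

theorem shift_pow_length (i : ZMod n) (l : ℕ) : shift (V q i l) ^ (l + 1) = 0 :=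
  V_hom_ext q fun m _ => by
    rw [shift_pow_vec, vec_eq_zero q (by omega), LinearMap.zero_apply]

/-- The coordinates on `V(i, l)`. -/
def vecCoord (i : ZMod n) (l : ℕ) (m : Fin (l + 1)) : (V q i l).carrier →ₗ[𝕜] 𝕜 :=
  Finsupp.lapply (M := 𝕜) (α := Fin (l + 1)) m

theorem vecCoord_vec (i : ZMod n) (l : ℕ) (m : Fin (l + 1)) (m' : ℕ) :
    vecCoord q i l m (vec q i l m') = if m' = m then 1 else 0 := by
  by_cases h : m' < l + 1
  · rw [show vec q i l m' = _ from vec_eq_single q i l ⟨m', h⟩]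
    refine (Finsupp.single_apply (M := 𝕜)).trans ?_
    simp only [Fin.ext_iff]
  · rw [vec_eq_zero q (by omega), map_zero, if_neg (by omega)]

/-- For m < l the m-th coordinate of v is the (m+1)-st coordinate of its shift, so only the last
coordinate can be nonzero. -/
theorem eq_smul_vec_of_shift_eq_zero {i : ZMod n} {l : ℕ} {v : (V q i l).carrier}
    (h : shift (V q i l) v = 0) : v = vecCoord q i l (Fin.last l) v • vec q i l l := by
  refine Finsupp.ext (M := 𝕜) (α := Fin (l + 1)) fun m => ?_
  change vecCoord q i l m v = vecCoord q i l m (vecCoord q i l (Fin.last l) v • vec q i l l)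
  rw [map_smul, vecCoord_vec]
  by_cases hm : l = m
  · have : m = Fin.last l := Fin.ext hm.symm
    subst this
    rw [if_pos hm, smul_eq_mul, mul_one]
  · rw [if_neg hm, smul_zero]
    have hlt : (m : ℕ) + 1 < l + 1 := by omega
    have e : vecCoord q i l m = vecCoord q i l ⟨m + 1, hlt⟩ ∘ₗ shift (V q i l) :=
      V_hom_ext q fun r _ => by
        rw [LinearMap.comp_apply, shift_vec, vecCoord_vec, vecCoord_vec]
        simp
    rw [e, LinearMap.comp_apply, h, map_zero]

variable {q} in
theorem exists_shift_eq_zero {W : Comod 𝕜 (CyclicPath q)} (hW : Nontrivial W.carrier) {r : ℕ}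
    (hr : shift W ^ r = 0) : ∃ w : W.carrier, w ≠ 0 ∧ shift W w = 0 := by
  obtain ⟨w, hw⟩ := exists_ne (0 : W.carrier)
  induction r generalizing w with
  | zero =>
    have := LinearMap.congr_fun hr w
    exact absurd this hw
  | succ r ih =>
    by_cases h : shift W ^ r = 0
    · exact ih h w hw
    · obtain ⟨v, hv⟩ : ∃ v, (shift W ^ r) v ≠ 0 := by
        by_contra! h'
        exact h (LinearMap.ext h')
      refine ⟨_, hv, ?_⟩
      rw [← Module.End.mul_apply, ← pow_succ', hr, LinearMap.zero_apply]

variable {q} in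
theorem _root_.Comod.IsHom.map_shift_pow {W W' : Comod 𝕜 (CyclicPath q)}
    {f : W.carrier →ₗ[𝕜] W'.carrier} (h : IsHom W W' f) (r : ℕ) (v : W.carrier) :
    f ((shift W ^ r) v) = (shift W' ^ r) (f v) := by
  induction r with
  | zero => simp
  | succ r ih => rw [pow_succ', pow_succ', Module.End.mul_apply, Module.End.mul_apply, h.map_shift,
      ih]

theorem indecomposable_V (i : ZMod n) (l : ℕ) : (V q i l).Indecomposable := by
  refine ⟨Module.nontrivial_of_finrank_pos (R := 𝕜) (by rw [finrank_V]; omega), ?_⟩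
  rintro A B ⟨e, he⟩
  have he' : IsHom (A.prod B) (V q i l) (e.symm : (A.prod B).carrier →ₗ[𝕜] (V q i l).carrier) :=
    IsHom.symm he
  have hinl (a : A.carrier) (h : Comod.inl A B a = 0) : a = 0 := by
    have := congrArg (Comod.desc (C := A) LinearMap.id 0) h
    rwa [Comod.desc_inl, map_zero] at this
  have hinr (b : B.carrier) (h : Comod.inr A B b = 0) : b = 0 := by
    have := congrArg (Comod.desc (C := B) 0 LinearMap.id) h
    rwa [Comod.desc_inr, map_zero] at this
  have hnil (x : (A.prod B).carrier) : (shift (A.prod B) ^ (l + 1)) x = 0 := by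
    have h1 := he'.map_shift_pow (l + 1) x
    rw [shift_pow_length, LinearMap.zero_apply] at h1
    exact (LinearEquiv.map_eq_zero_iff e.symm).1 h1
  by_contra! hAB
  obtain ⟨a, ha, ha'⟩ := exists_shift_eq_zero hAB.1 (r := l + 1) (LinearMap.ext fun a =>
    hinl _ (by rw [(Comod.isHom_inl A B).map_shift_pow, hnil]))
  obtain ⟨b, hb, hb'⟩ := exists_shift_eq_zero hAB.2 (r := l + 1) (LinearMap.ext fun b =>
    hinr _ (by rw [(Comod.isHom_inr A B).map_shift_pow, hnil]))
  -- The kernel of `shift` on the direct sum is a line, transported from V(i, l). It cannot contain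
  -- nonzero vectors from both summands.
  have key (x : (A.prod B).carrier) (hx : shift (A.prod B) x = 0) :
      ∃ c : 𝕜, x = c • e (vec q i l l) := by
    refine ⟨vecCoord q i l (Fin.last l) (e.symm x), e.symm.injective ?_⟩
    rw [map_smul, e.symm_apply_apply]
    refine eq_smul_vec_of_shift_eq_zero q ?_
    have := he'.map_shift x
    rw [hx, map_zero] at this
    exact this.symm
  obtain ⟨x, hx⟩ := key (Comod.inl A B a) (by rw [← (Comod.isHom_inl A B).map_shift, ha', map_zero])
  obtain ⟨y, hy⟩ := key (Comod.inr A B b) (by rw [← (Comod.isHom_inr A B).map_shift, hb', map_zero])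
  have hxy : y • Comod.inl A B a = x • Comod.inr A B b := by
    rw [hx, hy, smul_comm]
  have h1 := congrArg (Comod.desc (C := A) LinearMap.id 0) hxy
  rw [map_smul, map_smul, Comod.desc_inl, Comod.desc_inr, LinearMap.id_apply, LinearMap.zero_apply,
    smul_zero, smul_eq_zero, or_iff_left ha] at h1
  rw [h1, zero_smul] at hy
  exact hb (hinr b hy)

/-! The tensor product of two strings. -/

/-- The vector `v_i ⊗ v_j` of `V(0, a) ⊗ V(0, c)`. -/
def tvec (a c i j : ℕ) : (V q 0 a ⊗ᶜ V q 0 c).carrier :=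
  (vec q 0 a i ⊗ₜ[𝕜] vec q 0 c j : (V q 0 a).carrier ⊗[𝕜] (V q 0 c).carrier)

variable (a c : ℕ)

theorem tvec_eq_zero {i j : ℕ} (h : a + 1 ≤ i ∨ c + 1 ≤ j) : tvec q a c i j = 0 := by
  rcases h with h | h
  · rw [tvec, vec_eq_zero q (by omega)]
    exact TensorProduct.zero_tmul _ _
  · rw [tvec, vec_eq_zero q (by omega : c < j)]
    exact TensorProduct.tmul_zero _ _

theorem coact_tvec (i j : ℕ) {R : ℕ} (ha : a < R) (hc : c < R) :
    (V q 0 a ⊗ᶜ V q 0 c).coact (tvec q a c i j) =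
      ∑ r ∈ range R, ∑ t ∈ range R, tvec q a c (i + r) (j + t) ⊗ₜ[𝕜]
        ((root q ^ (i * t) * qBinom (root q) r t) • path q ((i + j : ℕ) : ZMod n) (r + t)) := by
  have : (V q 0 a ⊗ᶜ V q 0 c).coact (tvec q a c i j) =
      Comod.mulTensor _ _ _
        ((V q 0 a).coact (vec q 0 a i) ⊗ₜ[𝕜] (V q 0 c).coact (vec q 0 c j)) := by
    change Comod.tensorCoact _ _ (vec q 0 a i ⊗ₜ[𝕜] vec q 0 c j) = _
    rw [Comod.tensorCoact, LinearMap.comp_apply, TensorProduct.map_tmul]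
  rw [this, coact_vec q 0 a i ha, coact_vec q 0 c j hc, TensorProduct.sum_tmul, map_sum]
  refine Finset.sum_congr rfl fun r _ => ?_
  rw [TensorProduct.tmul_sum, map_sum]
  refine Finset.sum_congr rfl fun t _ => ?_
  rw [Comod.mulTensor_tmul, path_mul_path, zero_add, zero_add, qPow_natCast, ← pow_mul,
    Nat.cast_add]
  rfl

theorem act_tvec (k : ZMod n) (l i j : ℕ) {R : ℕ} (ha : a < R) (hc : c < R) :
    act (V q 0 a ⊗ᶜ V q 0 c) k l (tvec q a c i j) =
      ∑ r ∈ range R, ∑ t ∈ range R, if ((i + j : ℕ) : ZMod n) = k ∧ r + t = l then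
        (root q ^ (i * t) * qBinom (root q) r t) • tvec q a c (i + r) (j + t) else 0 := by
  rw [act_apply, coact_tvec q a c i j ha hc, map_sum]
  refine Finset.sum_congr rfl fun r _ => ?_
  rw [map_sum]
  refine Finset.sum_congr rfl fun t _ => ?_
  rw [TensorProduct.tmul_smul, map_smul, coeff_tmul_path, smul_ite, smul_zero]

theorem act_zero_tvec (k : ZMod n) (i j : ℕ) : act (V q 0 a ⊗ᶜ V q 0 c) k 0 (tvec q a c i j) =
    if k = (i + j : ℕ) then tvec q a c i j else 0 := by
  rw [act_tvec q a c k 0 i j (R := a + c + 1) (by omega) (by omega), Finset.sum_eq_single 0,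
    Finset.sum_eq_single 0]
  · simp [qBinom_zero_left, eq_comm]
  · intro t _ ht
    simp [ht]
  · simp
  · intro r _ hr
    simp [hr]
  · simp

/-- Length 1 splits only as 1 + 0 or 0 + 1. The factor q^i comes from multiplying the vertex i by an
arrow. -/
theorem shift_tvec (i j : ℕ) : shift (V q 0 a ⊗ᶜ V q 0 c) (tvec q a c i j) =
    tvec q a c (i + 1) j + root q ^ i • tvec q a c i (j + 1) := by
  rw [shift, LinearMap.sum_apply, Finset.sum_eq_single ((i + j : ℕ) : ZMod n)]
  · rw [act_tvec q a c _ 1 i j (R := a + c + 1 + 1) (by omega) (by omega), Finset.sum_range_succ',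
      Finset.sum_range_succ', Finset.sum_range_succ' _ (a + c + 1)]
    have h2 (x k : ℕ) : ¬ x + 1 + 1 + (k + 1 + 1) = 1 := by omega
    simp [qBinom_zero_left, Finset.sum_range_succ', qBinom_zero_right, h2]
  · intro k _ hk
    rw [act_tvec q a c k 1 i j (R := a + c + 1) (by omega) (by omega)]
    simp only [Ne.symm hk, false_and, if_false, Finset.sum_const_zero]
  · simp

theorem isGrid_tvec : IsGrid (root q) (shift (V q 0 a ⊗ᶜ V q 0 c)) (tvec q a c) :=
  shift_tvec q a c

theorem mem_of_forall_tvec_mem (R : Submodule 𝕜 (V q 0 a ⊗ᶜ V q 0 c).carrier)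
    (h : ∀ i j, tvec q a c i j ∈ R) (x : (V q 0 a ⊗ᶜ V q 0 c).carrier) : x ∈ R := by
  have : ∀ x : (V q 0 a).carrier ⊗[𝕜] (V q 0 c).carrier, x ∈ R := by
    have e : R.mkQ ∘ₗ (LinearMap.id : (V q 0 a).carrier ⊗[𝕜] (V q 0 c).carrier →ₗ[𝕜] _) = 0 := by
      refine TensorProduct.ext (V_hom_ext q fun i _ => V_hom_ext q fun j _ => ?_)
      exact (Submodule.Quotient.mk_eq_zero R).2 (h i j)
    intro x
    exact (Submodule.Quotient.mk_eq_zero R).1 (LinearMap.congr_fun e x)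
  exact this x

theorem finrank_tensor : Module.finrank 𝕜 (V q 0 a ⊗ᶜ V q 0 c).carrier = (a + 1) * (c + 1) := by
  rw [← finrank_V q 0 a, ← finrank_V q 0 c]
  exact Module.finrank_tensorProduct (R := 𝕜) (S := 𝕜) (M := (V q 0 a).carrier)
    (M' := (V q 0 c).carrier)

/-- Leading vectors are homogeneous, since T raises the degree by one; this makes them admissible
generators of strings. -/
theorem act_zero_of_gridLead {s : ℕ} {x : (V q 0 a ⊗ᶜ V q 0 c).carrier}
    (hx : GridLead (shift _) (tvec q a c) s x) : act (V q 0 a ⊗ᶜ V q 0 c) s 0 x = x := by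
  obtain ⟨r, -, w, hw, rfl⟩ := hx
  rw [map_add, map_smul, act_zero_tvec, zero_add, if_pos rfl]
  congr 1
  have key : gridBelow 𝕜 (tvec q a c) s ≤ LinearMap.ker
      (act (V q 0 a ⊗ᶜ V q 0 c) s 0 ∘ₗ shift _ - shift _) := by
    refine Submodule.span_le.2 ?_
    rintro _ ⟨i, j, rfl, rfl⟩
    change (act (V q 0 a ⊗ᶜ V q 0 c) ((i + j + 1 : ℕ) : ZMod n) 0 ∘ₗ shift (V q 0 a ⊗ᶜ V q 0 c) -
      shift (V q 0 a ⊗ᶜ V q 0 c)) (tvec q a c i j) = 0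
    rw [LinearMap.sub_apply, LinearMap.comp_apply, sub_eq_zero, Nat.cast_succ, act_zero_shift,
      act_zero_tvec, if_pos rfl]
  exact sub_eq_zero.1 (key hw)

/-- There is a vector with leading part in degree `s` that generates a quotient of
`V(s, l)`. -/
def HasString (s l : ℕ) : Prop :=
  ∃ x, GridLead (shift (V q 0 a ⊗ᶜ V q 0 c)) (tvec q a c) s x ∧ (shift _ ^ (l + 1)) x = 0

variable {a c} in
-- The image of the sum of the strings is T-stable and contains a leading vector in each degree up
-- to a, hence is everything. The dimension hypothesis then gives injectivity and forces each string
-- to have exactly the predicted length.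
theorem cls_tensor {L : ℕ → ℕ} (hL : ∀ s < a + 1, HasString q a c s (L s))
    (hdim : ∑ s ∈ range (a + 1), (L s + 1) = (a + 1) * (c + 1)) :
    (V q 0 a ⊗ᶜ V q 0 c).cls = ∑ s ∈ range (a + 1), (V q (s : ℕ) (L s)).cls := by
  choose! x hx hx' using hL
  rw [← Comod.cls_sum, eq_comm, Comod.cls_eq_iff]
  have hhom (s : range (a + 1)) :
      IsHom (V q ((s : ℕ) : ZMod n) (L s)) (V q 0 a ⊗ᶜ V q 0 c) (stringHom q (s : ℕ) (L s) (x s)) :=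
    isHom_stringHom q _ (act_zero_of_gridLead q a c (hx s (Finset.mem_range.1 s.2)))
      (hx' s (Finset.mem_range.1 s.2))
  have hH := IsHom.sumDesc (range (a + 1)) (fun s => V q ((s : ℕ) : ZMod n) (L s)) hhom
  refine hH.iso_of_surjective (fun y => ?_) ?_
  · refine mem_of_forall_tvec_mem q a c (LinearMap.range _) (fun i j => ?_) y
    refine (isGrid_tvec q a c).mem_of_gridLead (Units.ne_zero _)
      (fun j => tvec_eq_zero q a c (Or.inl le_rfl)) ?_ (fun s hs => ?_) i j
    · rintro _ ⟨z, rfl⟩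
      exact ⟨_, hH.map_shift z⟩
    · refine ⟨x s, ⟨Comod.incl _ _ ⟨s, Finset.mem_range.2 hs⟩ (vec q _ (L s) 0), ?_⟩, hx s hs⟩
      rw [Comod.sumDesc_incl, stringHom_vec q _ (Nat.zero_le _), pow_zero, Module.End.one_apply]
  · rw [Comod.finrank_sum, finrank_tensor, ← hdim]
    exact Finset.sum_congr rfl fun s _ => finrank_V q _ _

end

end CyclicPath

/-! ### Splitting sums by quotient and residue modulo d -/

section Sums

theorem sum_range_mul_add {M : Type*} [AddCommMonoid M] (F : ℕ → M) (e d r : ℕ) :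
    ∑ s ∈ range (e * d + r), F s =
      ∑ k ∈ range e, ∑ i ∈ range d, F (k * d + i) + ∑ i ∈ range r, F (e * d + i) := by
  rw [Finset.sum_range_add]
  congr 1
  induction e with
  | zero => simp
  | succ e ih => rw [add_mul, one_mul, Finset.sum_range_add, ih, Finset.sum_range_succ]

theorem sum_range_div_mod {M : Type*} [AddCommMonoid M] (F : ℕ → ℕ → M) (L : ℕ → ℕ → ℕ)
    {e d f : ℕ} (hf : f < d) : ∑ s ∈ range (e * d + (f + 1)), F s (L (s / d) (s % d)) =
      ∑ k ∈ range e, ∑ i ∈ range d, F (k * d + i) (L k i) +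
        ∑ i ∈ range (f + 1), F (e * d + i) (L e i) := by
  have hdiv (k i : ℕ) (hi : i < d) : (k * d + i) / d = k := by
    rw [mul_comm, Nat.mul_add_div (by omega), Nat.div_eq_of_lt hi, add_zero]
  have hmod (k i : ℕ) (hi : i < d) : (k * d + i) % d = i := by
    rw [mul_comm, Nat.mul_add_mod, Nat.mod_eq_of_lt hi]
  rw [sum_range_mul_add]
  congr 1
  · refine Finset.sum_congr rfl fun k _ => Finset.sum_congr rfl fun i hi => ?_
    rw [hdiv k i (Finset.mem_range.1 hi), hmod k i (Finset.mem_range.1 hi)]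
  · refine Finset.sum_congr rfl fun i hi => ?_
    have := Finset.mem_range.1 hi
    rw [hdiv e i (by omega), hmod e i (by omega)]

theorem sum_Icc_add_sum_Icc {M : Type*} [AddCommMonoid M] (F : ℕ → M) {a b c : ℕ} (hab : a ≤ b + 1)
    (hbc : b ≤ c) : ∑ i ∈ Icc a b, F i + ∑ i ∈ Icc (b + 1) c, F i = ∑ i ∈ Icc a c, F i := by
  have h (a b : ℕ) : Icc a b = Finset.Ico a (b + 1) := by
    ext
    simp
  rw [h, h, h]
  exact Finset.sum_Ico_consecutive F hab (by omega)

theorem range_succ_eq_Icc (r : ℕ) : range (r + 1) = Icc 0 r := by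
  ext
  simp

/-- The sum of an arithmetic progression. -/
theorem sum_Icc_linear {F : ℕ → ℕ} {a b : ℕ} {c t : ℤ} (hab : a ≤ b + 1)
    (h : ∀ i, a ≤ i → i ≤ b → (F i : ℤ) = c - 2 * t * i) :
    ((∑ i ∈ Icc a b, F i : ℕ) : ℤ) = (b + 1 - a) * (c - t * (a + b)) := by
  have key (r : ℕ) : ∑ i ∈ range r, (c - 2 * t * ((a + i : ℕ) : ℤ)) =
      r * (c - t * (2 * a + r - 1)) := by
    induction r with
    | zero => simp
    | succ r ih =>
      rw [Finset.sum_range_succ, ih]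
      push_cast
      ring
  have e : Icc a b = Finset.Ico a (b + 1) := by
    ext
    simp
  rw [e, Nat.cast_sum, Finset.sum_congr rfl (g := fun i : ℕ => c - 2 * t * (i : ℤ)) fun i hi => by
    have := Finset.mem_Ico.1 hi
    exact h i this.1 (by omega), Finset.sum_Ico_eq_sum_range, key, Nat.cast_sub hab]
  push_cast
  ring

theorem sum_range_sub_two_mul (c : ℤ) (e : ℕ) :
    ∑ k ∈ range e, (c - 2 * (k : ℤ)) = e * (c - e + 1) := by
  induction e with
  | zero => simp
  | succ e ih =>
    rw [Finset.sum_range_succ, ih]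
    push_cast
    ring

theorem sub_two_mul_mul {e m k d : ℕ} (h : 2 * k ≤ e + m) :
    (e + m - 2 * k) * d + 2 * (k * d) = e * d + m * d := by
  obtain ⟨p, hp⟩ := Nat.exists_eq_add_of_le h
  rw [hp, Nat.add_sub_cancel_left, ← add_mul, hp]
  ring

end Sums

/-! ### Existence of generators according to the residue -/

namespace CyclicPath

open Comod (cls)

variable {𝕜 : Type u} [Field 𝕜] {n : ℕ} [NeZero n] {q : rootsOfUnity n 𝕜} {d : ℕ}

/-- The generic Clebsch-Gordan length. The truncation orders of the grid are a + 1 and c + 1. -/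
theorem hasString_of_det_ne_zero {a c s l : ℕ} (ha : s ≤ a) (hc : s ≤ c)
    (hdet : (qMatrix (root q) (a + 1 - s) (c + 1 - s) s).det ≠ 0) (hl : l + 2 * s = a + c) :
    HasString q a c s l := by
  obtain ⟨x, hx, hx'⟩ := (isGrid_tvec q a c).exists_gridLead (α := a + 1) (β := c + 1)
    (fun i j h => tvec_eq_zero q a c h) (by omega) (by omega) hdet
  refine ⟨x, hx, ?_⟩
  rwa [show l + 1 = a + 1 + (c + 1) - 1 - 2 * s by omega]

theorem cls_tensor_blocks {e f m h : ℕ} (hf : f < d) {L : ℕ → ℕ → ℕ}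
    (hL : ∀ k < e, ∀ i < d, HasString q (e * d + f) (m * d + h) (k * d + i) (L k i))
    (hL' : ∀ i ≤ f, HasString q (e * d + f) (m * d + h) (e * d + i) (L e i))
    (hdim : ∑ k ∈ range e, ∑ i ∈ range d, (L k i + 1) + ∑ i ∈ range (f + 1), (L e i + 1) =
      (e * d + f + 1) * (m * d + h + 1)) :
    (V q 0 (e * d + f) ⊗ᶜ V q 0 (m * d + h)).cls =
      ∑ k ∈ range e, ∑ i ∈ range d, (V q (k * d + i : ℕ) (L k i)).cls +
        ∑ i ∈ range (f + 1), (V q (e * d + i : ℕ) (L e i)).cls := by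
  rw [cls_tensor q (L := fun s => L (s / d) (s % d)), add_assoc,
    sum_range_div_mod (fun s l => (V q (s : ℕ) l).cls) L hf]
  · intro s hs
    have h1 : s % d < d := Nat.mod_lt _ (by omega)
    have h2 : s / d * d + s % d = s := Nat.div_add_mod' s d
    rcases lt_trichotomy (s / d) e with h3 | h3 | h3
    · have := hL _ h3 _ h1
      rwa [h2] at this
    · have := hL' (s % d) (by rw [h3] at h2; omega)
      rw [← h3] at this ⊢
      rwa [h2] at this
    · have := Nat.mul_le_mul_right d h3
      rw [Nat.succ_mul] at this
      omega
  · rw [← hdim, add_assoc]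
    exact sum_range_div_mod (fun _ l => l + 1) L hf

variable [CharZero 𝕜]

/-- Here the matrix parameters have residues f + 1 - i and h + 1 - i modulo d. The hypothesis `hi`
says that adding these and i produces no carry. -/
theorem hasString_low (hq : IsPrimitiveRoot (root q) d) (hd : 2 ≤ d) {e f m h k i l : ℕ}
    (he : k ≤ e) (hm : k ≤ m) (hf : i ≤ f) (hh : i ≤ h) (hi : f + h + 2 ≤ d + i)
    (hl : l = (e + m - 2 * k) * d + (f + h) - 2 * i) :
    HasString q (e * d + f) (m * d + h) (k * d + i) l := by
  obtain ⟨e, rfl⟩ := Nat.exists_eq_add_of_le he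
  obtain ⟨m, rfl⟩ := Nat.exists_eq_add_of_le hm
  have h1 := sub_two_mul_mul (e := k + e) (m := k + m) (k := k) (d := d) (by omega)
  simp only [add_mul] at h1 ⊢
  refine hasString_of_det_ne_zero (by omega) (by omega) (det_qMatrix_ne_zero hq hd ?_) (by omega)
  rw [show k * d + e * d + f + 1 - (k * d + i) = e * d + (f + 1 - i) by omega,
    show k * d + m * d + h + 1 - (k * d + i) = m * d + (h + 1 - i) by omega]
  exact sum_range_div_low (by omega) (by omega) (by omega)

/-- Once i exceeds both f and h, each matrix parameter borrows a d, and the floor sums balance by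
`sum_range_div_high` with jumps f + 1 and h + 1. -/
theorem hasString_high (hq : IsPrimitiveRoot (root q) d) (hd : 2 ≤ d) {e f m h k i l : ℕ}
    (he : k < e) (hm : k < m) (hf : f < i) (hh : h < i) (hid : i < d) (hi : i ≤ f + h + 2)
    (hi' : f + h + 2 ≤ d + i) (hl : l = (e + m - 2 * k) * d + (f + h) - 2 * i) :
    HasString q (e * d + f) (m * d + h) (k * d + i) l := by
  obtain ⟨e, rfl⟩ := Nat.exists_eq_add_of_lt he
  obtain ⟨m, rfl⟩ := Nat.exists_eq_add_of_lt hm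
  have h1 := sub_two_mul_mul (e := k + e + 1) (m := k + m + 1) (k := k) (d := d) (by omega)
  simp only [add_mul, one_mul] at h1 ⊢
  refine hasString_of_det_ne_zero (by omega) (by omega) (det_qMatrix_ne_zero hq hd ?_) (by omega)
  rw [show k * d + e * d + d + f + 1 - (k * d + i) = e * d + (d - (i - (f + 1))) by omega,
    show k * d + m * d + d + h + 1 - (k * d + i) = m * d + (d - (i - (h + 1))) by omega]
  exact sum_range_div_high (by omega) (by omega) (by omega) (by omega) (by omega)

/-- The residue is split as i + j, and the sublattice through (i, j) is covered by e by m cells.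
Different splittings give different cell counts and hence different string lengths. -/
theorem hasString_of_dvd (hq : IsPrimitiveRoot (root q) d) (hd : 2 ≤ d) {a c e m i j k s l : ℕ}
    (ha : a < e * d + i) (hc : c < m * d + j) (he : k < e) (hm : k < m)
    (hs : k * d + (i + j) = s) (hl : l + 1 = (e + m - 1 - 2 * k) * d) : HasString q a c s l := by
  have h0 (t t' : ℕ) (h : e ≤ t ∨ m ≤ t') : tvec q a c (t * d + i) (t' * d + j) = 0 := by
    refine tvec_eq_zero q a c ?_
    rcases h with h | h
    · have := Nat.mul_le_mul_right d h
      omega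
    · have := Nat.mul_le_mul_right d h
      omega
  obtain ⟨x, hx, hx'⟩ :=
    (isGrid_tvec q a c).exists_gridLead_of_dvd hq (by omega) h0 he hm hs
  exact ⟨x, hx, by rwa [hl]⟩

end CyclicPath

/-! ### The dimension count -/

section Sums

theorem sum_Icc_congr {M : Type*} [AddCommMonoid M] {F G : ℕ → M} {a b : ℕ}
    (h : ∀ i, a ≤ i → i ≤ b → F i = G i) : ∑ i ∈ Icc a b, F i = ∑ i ∈ Icc a b, G i :=
  Finset.sum_congr rfl fun i hi => h i (Finset.mem_Icc.1 hi).1 (Finset.mem_Icc.1 hi).2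

theorem sum_range_eq_three {M : Type*} [AddCommMonoid M] (F : ℕ → M) {r u v : ℕ}
    (huv : u ≤ v) (hvr : v < r) : ∑ i ∈ range r, F i =
      ∑ i ∈ Icc 0 u, F i + ∑ i ∈ Icc (u + 1) v, F i + ∑ i ∈ Icc (v + 1) (r - 1), F i := by
  rw [sum_Icc_add_sum_Icc F (by omega) huv, sum_Icc_add_sum_Icc F (by omega) (by omega),
    ← range_succ_eq_Icc, Nat.sub_add_cancel (by omega)]

theorem sum_range_eq_four {M : Type*} [AddCommMonoid M] (F : ℕ → M) {r u v w : ℕ}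
    (huv : u ≤ v) (hvw : v ≤ w) (hwr : w < r) : ∑ i ∈ range r, F i =
      ∑ i ∈ Icc 0 u, F i + ∑ i ∈ Icc (u + 1) v, F i + ∑ i ∈ Icc (v + 1) w, F i +
        ∑ i ∈ Icc (w + 1) (r - 1), F i := by
  rw [sum_range_eq_three F huv (hvw.trans_lt hwr),
    ← sum_Icc_add_sum_Icc F (a := v + 1) (b := w) (by omega) (by omega), ← add_assoc]

/-- All cases give the same dimension for a full block of d residues and for the final block, so the
total is checked only once. The integers avoid truncated subtraction. -/
theorem sum_blocks_eq {e f m h d : ℕ} {L : ℕ → ℕ → ℕ}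
    (h1 : ∀ k < e, ((∑ i ∈ range d, (L k i + 1) : ℕ) : ℤ) =
      d * d * ((e + m) - 2 * k) - d * (d - f - h - 2))
    (h2 : ((∑ i ∈ range (f + 1), (L e i + 1) : ℕ) : ℤ) =
      (f + 1) * ((m - e) * d) + (f + 1) * (h + 1)) :
    ∑ k ∈ range e, ∑ i ∈ range d, (L k i + 1) + ∑ i ∈ range (f + 1), (L e i + 1) =
      (e * d + f + 1) * (m * d + h + 1) := by
  zify
  have h3 := Finset.sum_congr rfl fun k hk => h1 k (Finset.mem_range.1 hk)
  rw [Finset.sum_sub_distrib, ← Finset.mul_sum, sum_range_sub_two_mul] at h3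
  simp only [Finset.sum_const, Finset.card_range, nsmul_eq_mul] at h3
  push_cast at h2 h3
  rw [h3, h2]
  ring

end Sums

/-! ### The decompositions for f + h < d - 1 and for f + h ≥ d -/

namespace CyclicPath

open Comod (cls)

variable {d : ℕ}

theorem le_of_mul_add_le {e f m h : ℕ} (hh : h < d) (hle : e * d + f ≤ m * d + h) : e ≤ m := by
  by_contra! hlt
  have := Nat.mul_le_mul_right d hlt
  rw [Nat.succ_mul] at this
  omega

theorem lt_of_mul_add_le {e f m h : ℕ} (hhf : h < f) (hle : e * d + f ≤ m * d + h) : e < m := by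
  by_contra! hlt
  have := Nat.mul_le_mul_right d hlt
  omega

variable {𝕜 : Type u} [Field 𝕜] [CharZero 𝕜] {n : ℕ} [NeZero n] {q : rootsOfUnity n 𝕜}

/-- When i lies between f and h, the whole residue is put on the factor with the smaller remainder.
That factor then needs no extra cell, while the other needs one. -/
theorem hasString_middle (hq : IsPrimitiveRoot (root q) d) (hd : 2 ≤ d) {e f m h k i l : ℕ}
    (hi : (f < i ∧ i ≤ h ∧ k < e ∧ k ≤ m) ∨ (h < i ∧ i ≤ f ∧ k ≤ e ∧ k < m)) (hf : f < d)
    (hh : h < d) (hl : l = (e + m - 2 * k) * d - 1) :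
    HasString q (e * d + f) (m * d + h) (k * d + i) l := by
  have hpos : 0 < (e + m - 2 * k) * d := Nat.mul_pos (by omega) (by omega)
  rcases hi with ⟨h1, h2, h3, h4⟩ | ⟨h1, h2, h3, h4⟩
  · refine hasString_of_dvd hq hd (i := i) (j := 0) (e := e) (m := m + 1) (k := k) ?_ ?_
      (by omega) (by omega) (by omega) ?_
    · omega
    · rw [add_mul]
      omega
    · rw [show e + (m + 1) - 1 - 2 * k = e + m - 2 * k by omega]
      omega
  · refine hasString_of_dvd hq hd (i := 0) (j := i) (e := e + 1) (m := m) (k := k) ?_ ?_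
      (by omega) (by omega) (by omega) ?_
    · rw [add_mul]
      omega
    · omega
    · rw [show e + 1 + m - 1 - 2 * k = e + m - 2 * k by omega]
      omega

/-- The tensor product of two strings without summands of the largest type. -/
theorem cls_tensor_of_add_lt (hq : IsPrimitiveRoot (root q) d) (hd : 2 ≤ d) {e f m h u v : ℕ}
    (huv : (f ≤ h ∧ u = f ∧ v = h) ∨ (h < f ∧ u = h ∧ v = f)) (hS : f + h + 1 < d)
    (hle : e * d + f ≤ m * d + h) :
    (V q 0 (e * d + f) ⊗ᶜ V q 0 (m * d + h)).cls =
      ∑ k ∈ range e,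
        (∑ i ∈ Icc 0 u, (V q (k * d + i : ℕ) ((e + m - 2 * k) * d + (f + h) - 2 * i)).cls +
        ∑ i ∈ Icc (u + 1) v, (V q (k * d + i : ℕ) ((e + m - 2 * k) * d - 1)).cls +
        ∑ i ∈ Icc (v + 1) (f + h + 1),
          (V q (k * d + i : ℕ) ((e + m - 2 * k) * d + (f + h) - 2 * i)).cls +
        ∑ i ∈ Icc (f + h + 2) (d - 1), (V q (k * d + i : ℕ) ((e + m - 1 - 2 * k) * d - 1)).cls) +
      (∑ i ∈ Icc 0 u, (V q (e * d + i : ℕ) ((m - e) * d + (f + h) - 2 * i)).cls +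
        ∑ i ∈ Icc (u + 1) f, (V q (e * d + i : ℕ) ((m - e) * d - 1)).cls) := by
  have hem : e ≤ m := le_of_mul_add_le (by omega) hle
  have hem' : h < f → e < m := fun h => lt_of_mul_add_le h hle
  -- Here u and v are the minimum and maximum of f and h. The four ranges are treated in turn by
  -- `hasString_low`, `hasString_middle`, `hasString_high`, and T^d without extra cells.
  obtain ⟨L, hL⟩ : ∃ L : ℕ → ℕ → ℕ, ∀ k i, L k i =
      if i ≤ u then (e + m - 2 * k) * d + (f + h) - 2 * i
      else if i ≤ v then (e + m - 2 * k) * d - 1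
      else if i ≤ f + h + 1 then (e + m - 2 * k) * d + (f + h) - 2 * i
      else (e + m - 1 - 2 * k) * d - 1 := ⟨_, fun _ _ => rfl⟩
  have l1 (k i : ℕ) (h1 : i ≤ u) : L k i = (e + m - 2 * k) * d + (f + h) - 2 * i := by
    rw [hL, if_pos h1]
  have l2 (k i : ℕ) (h1 : u + 1 ≤ i) (h2 : i ≤ v) : L k i = (e + m - 2 * k) * d - 1 := by
    rw [hL, if_neg (by omega), if_pos h2]
  have l3 (k i : ℕ) (h1 : v + 1 ≤ i) (h2 : i ≤ f + h + 1) :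
      L k i = (e + m - 2 * k) * d + (f + h) - 2 * i := by
    rw [hL, if_neg (by omega), if_neg (by omega), if_pos h2]
  have l4 (k i : ℕ) (h1 : f + h + 2 ≤ i) : L k i = (e + m - 1 - 2 * k) * d - 1 := by
    rw [hL, if_neg (by omega), if_neg (by omega), if_neg (by omega)]
  have hme : e + m - 2 * e = m - e := by omega
  rw [cls_tensor_blocks (L := L) (by omega)]
  · congr 1
    · refine Finset.sum_congr rfl fun k hk => ?_
      rw [sum_range_eq_four _ (show u ≤ v by omega) (show v ≤ f + h + 1 by omega) hS]
      congr 1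
      · congr 1
        · congr 1
          · exact sum_Icc_congr fun i _ h2 => by rw [l1 k i h2]
          · exact sum_Icc_congr fun i h1 h2 => by rw [l2 k i h1 h2]
        · exact sum_Icc_congr fun i h1 h2 => by rw [l3 k i h1 h2]
      · exact sum_Icc_congr fun i h1 _ => by rw [l4 k i h1]
    · rw [range_succ_eq_Icc, ← sum_Icc_add_sum_Icc _ (show 0 ≤ u + 1 by omega)
        (show u ≤ f by omega)]
      congr 1
      · exact sum_Icc_congr fun i _ h2 => by rw [l1 e i h2, hme]
      · exact sum_Icc_congr fun i h1 h2 => by rw [l2 e i h1 (by omega), hme]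
  · intro k hk i hi
    rcases le_or_gt i u with c1 | c1
    · exact hasString_low hq hd (by omega) (by omega) (by omega) (by omega) (by omega) (l1 k i c1)
    rcases le_or_gt i v with c2 | c2
    · exact hasString_middle hq hd (by omega) (by omega) (by omega) (l2 k i c1 c2)
    rcases le_or_gt i (f + h + 1) with c3 | c3
    · exact hasString_high hq hd (by omega) (by omega) (by omega) (by omega) (by omega) (by omega)
        (by omega) (l3 k i c2 c3)
    -- The first part f + 1 exceeds f, and the rest i - (f + 1) exceeds h because i > f + h + 1.
    -- Neither factor needs an extra cell.
    · refine hasString_of_dvd hq hd (i := f + 1) (j := i - (f + 1)) (e := e) (m := m) (k := k)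
        (by omega) (by omega) (by omega) (by omega) (by omega) ?_
      have hpos : 0 < (e + m - 1 - 2 * k) * d := Nat.mul_pos (by omega) (by omega)
      rw [l4 k i c3]
      omega
  · intro i hi
    rcases le_or_gt i u with c1 | c1
    · exact hasString_low hq hd (by omega) (by omega) (by omega) (by omega) (by omega) (l1 e i c1)
    · exact hasString_middle hq hd (by omega) (by omega) (by omega) (l2 e i c1 (by omega))
  · refine sum_blocks_eq (m := m) (h := h) (fun k hk => ?_) ?_
    -- As k < e ≤ m, e + m is at least 2k + 2; naming the excess p removes truncated subtraction
    -- from the lengths.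
    · obtain ⟨p, hp⟩ := Nat.exists_eq_add_of_le (show 2 * k + 2 ≤ e + m by omega)
      have e1 : e + m - 2 * k = p + 2 := by omega
      have e2 : e + m - 1 - 2 * k = p + 1 := by omega
      replace l1 := l1 k
      replace l2 := l2 k
      replace l3 := l3 k
      replace l4 := l4 k
      simp only [e1, e2, add_mul, one_mul] at l1 l2 l3 l4
      rw [sum_range_eq_four _ (show u ≤ v by omega) (show v ≤ f + h + 1 by omega) hS]
      rw [Nat.cast_add, Nat.cast_add, Nat.cast_add]
      rw [sum_Icc_linear (c := (p + 2) * d + (f + h) + 1) (t := 1) (by omega) fun i _ h2 => by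
          rw [l1 i h2]
          push_cast [Nat.cast_sub (show 2 * i ≤ p * d + 2 * d + (f + h) by omega)]
          ring,
        sum_Icc_linear (c := (p + 2) * d) (t := 0) (by omega) fun i h1 h2 => by
          rw [l2 i h1 h2]
          push_cast [Nat.cast_sub (show 1 ≤ p * d + 2 * d by omega)]
          ring,
        sum_Icc_linear (c := (p + 2) * d + (f + h) + 1) (t := 1) (by omega) fun i h1 h2 => by
          rw [l3 i h1 h2]
          push_cast [Nat.cast_sub (show 2 * i ≤ p * d + 2 * d + (f + h) by omega)]
          ring,
        sum_Icc_linear (c := (p + 1) * d) (t := 0) (by omega) fun i h1 h2 => by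
          rw [l4 i h1]
          push_cast [Nat.cast_sub (show 1 ≤ p * d + d by omega)]
          ring]
      have hp' : (e : ℤ) + m = 2 * k + 2 + p := by exact_mod_cast hp
      have hv : (v : ℤ) = f + h - u := by omega
      push_cast [Nat.cast_sub (show 1 ≤ d by omega)]
      rw [hp', hv]
      ring
    · obtain ⟨p, rfl⟩ := Nat.exists_eq_add_of_le hem
      replace l1 := l1 e
      replace l2 := l2 e
      simp only [show e + (e + p) - 2 * e = p by omega] at l1 l2
      rw [range_succ_eq_Icc, ← sum_Icc_add_sum_Icc _ (show 0 ≤ u + 1 by omega)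
        (show u ≤ f by omega), Nat.cast_add]
      rw [sum_Icc_linear (c := p * d + (f + h) + 1) (t := 1) (by omega) fun i _ h2 => by
          rw [l1 i h2]
          push_cast [Nat.cast_sub (show 2 * i ≤ p * d + (f + h) by omega)]
          ring,
        sum_Icc_linear (c := p * d) (t := 0) (by omega) fun i h1 h2 => by
          -- This range is nonempty only if h < f, which forces e < m; so p is positive and
          -- subtracting 1 is harmless.
          have := Nat.mul_pos (show 0 < p by omega) (show 0 < d by omega)
          rw [l2 i h1 (by omega)]
          push_cast [Nat.cast_sub (show 1 ≤ p * d by omega)]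
          ring]
      rcases huv with ⟨-, rfl, rfl⟩ | ⟨-, rfl, rfl⟩ <;> push_cast <;> ring

/-- The tensor product of two strings with summands of the largest type. -/
theorem cls_tensor_of_le_add (hq : IsPrimitiveRoot (root q) d) (hd : 2 ≤ d) {e f m h u v : ℕ}
    (huv : (f ≤ h ∧ u = f ∧ v = h) ∨ (h < f ∧ u = h ∧ v = f)) (hf : f < d) (hh : h < d)
    (hS : d ≤ f + h) (hle : e * d + f ≤ m * d + h) :
    (V q 0 (e * d + f) ⊗ᶜ V q 0 (m * d + h)).cls =
      ∑ k ∈ range e,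
        (∑ i ∈ Icc 0 (f + h + 1 - d), (V q (k * d + i : ℕ) ((e + m - 2 * k) * d + d - 1)).cls +
        ∑ i ∈ Icc (f + h + 1 - d + 1) u,
          (V q (k * d + i : ℕ) ((e + m - 2 * k) * d + (f + h) - 2 * i)).cls +
        ∑ i ∈ Icc (u + 1) v, (V q (k * d + i : ℕ) ((e + m - 2 * k) * d - 1)).cls +
        ∑ i ∈ Icc (v + 1) (d - 1),
          (V q (k * d + i : ℕ) ((e + m - 2 * k) * d + (f + h) - 2 * i)).cls) +
      (∑ i ∈ Icc 0 (f + h + 1 - d), (V q (e * d + i : ℕ) ((m - e) * d + d - 1)).cls +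
        ∑ i ∈ Icc (f + h + 1 - d + 1) u,
          (V q (e * d + i : ℕ) ((m - e) * d + (f + h) - 2 * i)).cls +
        ∑ i ∈ Icc (u + 1) f, (V q (e * d + i : ℕ) ((m - e) * d - 1)).cls) := by
  have hem : e ≤ m := le_of_mul_add_le (by omega) hle
  have hem' : h < f → e < m := fun h => lt_of_mul_add_le h hle
  obtain ⟨g, hg⟩ : ∃ g, f + h + 1 - d = g := ⟨_, rfl⟩
  rw [hg]
  obtain ⟨L, hL⟩ : ∃ L : ℕ → ℕ → ℕ, ∀ k i, L k i =
      if i ≤ g then (e + m - 2 * k) * d + d - 1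
      else if i ≤ u then (e + m - 2 * k) * d + (f + h) - 2 * i
      else if i ≤ v then (e + m - 2 * k) * d - 1
      else (e + m - 2 * k) * d + (f + h) - 2 * i := ⟨_, fun _ _ => rfl⟩
  have l1 (k i : ℕ) (h1 : i ≤ g) : L k i = (e + m - 2 * k) * d + d - 1 := by
    rw [hL, if_pos h1]
  have l2 (k i : ℕ) (h1 : g + 1 ≤ i) (h2 : i ≤ u) :
      L k i = (e + m - 2 * k) * d + (f + h) - 2 * i := by
    rw [hL, if_neg (by omega), if_pos h2]
  have l3 (k i : ℕ) (h1 : u + 1 ≤ i) (h2 : i ≤ v) : L k i = (e + m - 2 * k) * d - 1 := by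
    rw [hL, if_neg (by omega), if_neg (by omega), if_pos h2]
  have l4 (k i : ℕ) (h1 : v + 1 ≤ i) : L k i = (e + m - 2 * k) * d + (f + h) - 2 * i := by
    rw [hL, if_neg (by omega), if_neg (by omega), if_neg (by omega)]
  have hme : e + m - 2 * e = m - e := by omega
  -- One extra cell on each factor always suffices and gives dimension (e + m + 1 - 2k) d. It is
  -- used for the residues up to f + h + 1 - d, including those of the final block k = e.
  have hmax (k i : ℕ) (hke : k ≤ e) (hi : i ≤ g) :
      HasString q (e * d + f) (m * d + h) (k * d + i) (L k i) := by
    refine hasString_of_dvd hq hd (i := i) (j := 0) (e := e + 1) (m := m + 1) (k := k) ?_ ?_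
      (by omega) (by omega) (by omega) ?_
    · rw [add_mul]
      omega
    · rw [add_mul]
      omega
    · rw [l1 k i hi, show e + 1 + (m + 1) - 1 - 2 * k = e + m - 2 * k + 1 by omega, add_mul]
      omega
  rw [cls_tensor_blocks (L := L) (by omega)]
  · congr 1
    · refine Finset.sum_congr rfl fun k hk => ?_
      rw [sum_range_eq_four _ (show g ≤ u by omega) (show u ≤ v by omega) (show v < d by omega)]
      congr 1
      · congr 1
        · congr 1
          · exact sum_Icc_congr fun i _ h2 => by rw [l1 k i h2]
          · exact sum_Icc_congr fun i h1 h2 => by rw [l2 k i h1 h2]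
        · exact sum_Icc_congr fun i h1 h2 => by rw [l3 k i h1 h2]
      · exact sum_Icc_congr fun i h1 _ => by rw [l4 k i h1]
    · rw [sum_range_eq_three _ (show g ≤ u by omega) (show u < f + 1 by omega),
        Nat.add_sub_cancel]
      congr 1
      · congr 1
        · exact sum_Icc_congr fun i _ h2 => by rw [l1 e i h2, hme]
        · exact sum_Icc_congr fun i h1 h2 => by rw [l2 e i h1 h2, hme]
      · exact sum_Icc_congr fun i h1 h2 => by rw [l3 e i h1 (by omega), hme]
  · intro k hk i hi
    rcases le_or_gt i g with c1 | c1
    · exact hmax k i hk.le c1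
    rcases le_or_gt i u with c2 | c2
    · exact hasString_low hq hd (by omega) (by omega) (by omega) (by omega) (by omega)
        (l2 k i c1 c2)
    rcases le_or_gt i v with c3 | c3
    · exact hasString_middle hq hd (by omega) (by omega) (by omega) (l3 k i c2 c3)
    · exact hasString_high hq hd (by omega) (by omega) (by omega) (by omega) (by omega) (by omega)
        (by omega) (l4 k i c3)
  · intro i hi
    rcases le_or_gt i g with c1 | c1
    · exact hmax e i le_rfl c1
    rcases le_or_gt i u with c2 | c2
    · exact hasString_low hq hd (by omega) (by omega) (by omega) (by omega) (by omega)
        (l2 e i c1 c2)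
    · exact hasString_middle hq hd (by omega) (by omega) (by omega) (l3 e i c2 (by omega))
  -- Over the integers this identity is exact because f + h ≥ d, so g can eliminate d from the
  -- polynomial identities.
  · have hd' : (d : ℤ) = f + h + 1 - g := by omega
    refine sum_blocks_eq (m := m) (h := h) (fun k hk => ?_) ?_
    · obtain ⟨p, hp⟩ := Nat.exists_eq_add_of_le (show 2 * k + 2 ≤ e + m by omega)
      have e1 : e + m - 2 * k = p + 2 := by omega
      replace l1 := l1 k
      replace l2 := l2 k
      replace l3 := l3 k
      replace l4 := l4 k
      simp only [e1, add_mul] at l1 l2 l3 l4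
      rw [sum_range_eq_four _ (show g ≤ u by omega) (show u ≤ v by omega) (show v < d by omega)]
      rw [Nat.cast_add, Nat.cast_add, Nat.cast_add]
      rw [sum_Icc_linear (c := (p + 3) * d) (t := 0) (by omega) fun i _ h2 => by
          rw [l1 i h2]
          push_cast [Nat.cast_sub (show 1 ≤ p * d + 2 * d + d by omega)]
          ring,
        sum_Icc_linear (c := (p + 2) * d + (f + h) + 1) (t := 1) (by omega) fun i h1 h2 => by
          rw [l2 i h1 h2]
          push_cast [Nat.cast_sub (show 2 * i ≤ p * d + 2 * d + (f + h) by omega)]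
          ring,
        sum_Icc_linear (c := (p + 2) * d) (t := 0) (by omega) fun i h1 h2 => by
          rw [l3 i h1 h2]
          push_cast [Nat.cast_sub (show 1 ≤ p * d + 2 * d by omega)]
          ring,
        sum_Icc_linear (c := (p + 2) * d + (f + h) + 1) (t := 1) (by omega) fun i h1 h2 => by
          rw [l4 i h1]
          push_cast [Nat.cast_sub (show 2 * i ≤ p * d + 2 * d + (f + h) by omega)]
          ring]
      have hp' : (e : ℤ) + m = 2 * k + 2 + p := by exact_mod_cast hp
      have hv : (v : ℤ) = f + h - u := by omega
      push_cast [Nat.cast_sub (show 1 ≤ d by omega)]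
      rw [hp', hv]
      rw [hd']
      ring
    · obtain ⟨p, rfl⟩ := Nat.exists_eq_add_of_le hem
      replace l1 := l1 e
      replace l2 := l2 e
      replace l3 := l3 e
      simp only [show e + (e + p) - 2 * e = p by omega] at l1 l2 l3
      rw [sum_range_eq_three _ (show g ≤ u by omega) (show u < f + 1 by omega),
        Nat.add_sub_cancel]
      rw [Nat.cast_add, Nat.cast_add]
      rw [sum_Icc_linear (c := (p + 1) * d) (t := 0) (by omega) fun i _ h2 => by
          rw [l1 i h2]
          push_cast [Nat.cast_sub (show 1 ≤ p * d + d by omega)]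
          ring,
        sum_Icc_linear (c := p * d + (f + h) + 1) (t := 1) (by omega) fun i h1 h2 => by
          rw [l2 i h1 h2]
          push_cast [Nat.cast_sub (show 2 * i ≤ p * d + (f + h) by omega)]
          ring,
        sum_Icc_linear (c := p * d) (t := 0) (by omega) fun i h1 h2 => by
          have := Nat.mul_pos (show 0 < p by omega) (show 0 < d by omega)
          rw [l3 i h1 (by omega)]
          push_cast [Nat.cast_sub (show 1 ≤ p * d by omega)]
          ring]
      push_cast
      rcases huv with ⟨-, rfl, rfl⟩ | ⟨-, rfl, rfl⟩ <;> rw [hd'] <;> ring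

end CyclicPath

theorem theorem3p18 {𝕜 : Type u} [Field 𝕜] [IsAlgClosed 𝕜] [CharZero 𝕜] {n : ℕ} [NeZero n]
    (q : rootsOfUnity n 𝕜) (d : ℕ) (hd : 2 ≤ d) (hq : orderOf q = d) :
    -- the `V(i, l)` are indecomposable
    (∀ (i : ZMod n) (l : ℕ), (V q i l).Indecomposable) ∧
    -- the decompositions; no subtraction of natural numbers below is ever truncated
    ∀ e f m h : ℕ, f < d → h < d → e * d + f ≤ m * d + h →
      (f ≤ h → f + h < d - 1 →
        V q 0 (e * d + f) ⊗ᶜ V q 0 (m * d + h) ≅ᶜ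
          Comod.sum (range e) (fun k =>
            Comod.sum (Icc 0 f) (fun i =>
              V q (k * d + i : ℕ) ((e + m - 2 * k) * d + f + h - 2 * i)) ⊕ᶜ
            Comod.sum (Icc (f + 1) h) (fun j =>
              V q (k * d + j : ℕ) ((e + m - 2 * k) * d - 1)) ⊕ᶜ
            Comod.sum (Icc (h + 1) (f + h + 1)) (fun r =>
              V q (k * d + r : ℕ) ((e + m - 2 * k) * d + h + f - 2 * r)) ⊕ᶜ
            Comod.sum (Icc (f + h + 2) (d - 1)) (fun s =>
              V q (k * d + s : ℕ) ((e + m - 1 - 2 * k) * d - 1))) ⊕ᶜ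
          Comod.sum (Icc 0 f) (fun i =>
            V q (e * d + i : ℕ) ((m - e) * d + h + f - 2 * i))) ∧
      (0 < f → f ≤ h → d ≤ f + h →
        V q 0 (e * d + f) ⊗ᶜ V q 0 (m * d + h) ≅ᶜ
          Comod.sum (range e) (fun k =>
            Comod.sum (Icc 0 (f + h + 1 - d)) (fun i =>
              V q (k * d + i : ℕ) ((e + m - 2 * k) * d + d - 1)) ⊕ᶜ
            Comod.sum (Icc (f + h + 1 - d + 1) f) (fun j =>
              V q (k * d + j : ℕ) ((e + m - 2 * k) * d + f + h - 2 * j)) ⊕ᶜ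
            Comod.sum (Icc (f + 1) h) (fun r =>
              V q (k * d + r : ℕ) ((e + m - 2 * k) * d - 1)) ⊕ᶜ
            Comod.sum (Icc (h + 1) (d - 1)) (fun s =>
              V q (k * d + s : ℕ) ((e + m - 2 * k) * d + h + f - 2 * s))) ⊕ᶜ
          Comod.sum (Icc 0 (f + h + 1 - d)) (fun i =>
            V q (e * d + i : ℕ) ((m - e) * d + d - 1)) ⊕ᶜ
          Comod.sum (Icc (f + h + 1 - d + 1) f) (fun i =>
            V q (e * d + i : ℕ) ((m - e) * d + f + h - 2 * i))) ∧
      (h < f → f + h < d - 1 →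
        V q 0 (e * d + f) ⊗ᶜ V q 0 (m * d + h) ≅ᶜ
          Comod.sum (range e) (fun k =>
            Comod.sum (Icc 0 h) (fun i =>
              V q (k * d + i : ℕ) ((e + m - 2 * k) * d + h + f - 2 * i)) ⊕ᶜ
            Comod.sum (Icc (h + 1) f) (fun j =>
              V q (k * d + j : ℕ) ((e + m - 2 * k) * d - 1)) ⊕ᶜ
            Comod.sum (Icc (f + 1) (h + f + 1)) (fun r =>
              V q (k * d + r : ℕ) ((e + m - 2 * k) * d + h + f - 2 * r)) ⊕ᶜ
            Comod.sum (Icc (f + h + 2) (d - 1)) (fun s =>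
              V q (k * d + s : ℕ) ((e + m - 1 - 2 * k) * d - 1))) ⊕ᶜ
          Comod.sum (Icc 0 h) (fun i =>
            V q (e * d + i : ℕ) ((m - e) * d + h + f - 2 * i)) ⊕ᶜ
          Comod.sum (Icc (h + 1) f) (fun i =>
            V q (e * d + i : ℕ) ((m - e) * d - 1))) ∧
      (0 < h → h < f → d ≤ f + h →
        V q 0 (e * d + f) ⊗ᶜ V q 0 (m * d + h) ≅ᶜ
          Comod.sum (range e) (fun k =>
            Comod.sum (Icc 0 (f + h + 1 - d)) (fun i =>
              V q (k * d + i : ℕ) ((e + m - 2 * k) * d + d - 1)) ⊕ᶜ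
            Comod.sum (Icc (f + h + 1 - d + 1) h) (fun j =>
              V q (k * d + j : ℕ) ((e + m - 2 * k) * d + f + h - 2 * j)) ⊕ᶜ
            Comod.sum (Icc (h + 1) f) (fun r =>
              V q (k * d + r : ℕ) ((e + m - 2 * k) * d - 1)) ⊕ᶜ
            Comod.sum (Icc (f + 1) (d - 1)) (fun s =>
              V q (k * d + s : ℕ) ((e + m - 2 * k) * d + h + f - 2 * s))) ⊕ᶜ
          Comod.sum (Icc 0 (f + h + 1 - d)) (fun i =>
            V q (e * d + i : ℕ) ((m - e) * d + d - 1)) ⊕ᶜ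
          Comod.sum (Icc (f + h + 1 - d + 1) h) (fun i =>
            V q (e * d + i : ℕ) ((m - e) * d + f + h - 2 * i)) ⊕ᶜ
          Comod.sum (Icc (h + 1) f) (fun i =>
            V q (e * d + i : ℕ) ((m - e) * d - 1))) := by
  have hr : IsPrimitiveRoot (CyclicPath.root q) d := by
    have h1 : IsPrimitiveRoot q d := hq ▸ IsPrimitiveRoot.orderOf q
    have h2 := h1.map_of_injective (f := (rootsOfUnity n 𝕜).subtype) Subtype.val_injective
    exact h2.map_of_injective (f := Units.coeHom 𝕜) Units.val_injective
  refine ⟨CyclicPath.indecomposable_V q, fun e f m h hf hh hle => ⟨fun hfh hS => ?_,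
    fun _ hfh hS => ?_, fun hfh hS => ?_, fun _ hfh hS => ?_⟩⟩
  -- In the monoid of isomorphism classes each claim is an identity of finite sums; the
  -- associativity rewrites bring f + h and h + f to one form.
  all_goals
    rw [← Comod.cls_eq_iff]
    simp only [Comod.cls_prod, Comod.cls_sum, add_assoc _ f h, add_assoc _ h f, add_comm h f]
  -- For f ≤ h the final block has no middle range: its index interval from f + 1 to f is empty.
  · rw [CyclicPath.cls_tensor_of_add_lt hr hd (Or.inl ⟨hfh, rfl, rfl⟩) (by omega) hle,
      Finset.Icc_eq_empty (a := f + 1) (b := f) (by omega), Finset.sum_empty, add_zero]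
  · rw [CyclicPath.cls_tensor_of_le_add hr hd (Or.inl ⟨hfh, rfl, rfl⟩) hf hh hS hle,
      Finset.Icc_eq_empty (a := f + 1) (b := f) (by omega), Finset.sum_empty, add_zero]
    simp only [add_assoc]
  · rw [CyclicPath.cls_tensor_of_add_lt hr hd (Or.inr ⟨hfh, rfl, rfl⟩) (by omega) hle]
    simp only [add_assoc]
  · rw [CyclicPath.cls_tensor_of_le_add hr hd (Or.inr ⟨hfh, rfl, rfl⟩) hf hh hS hle]
    simp only [add_assoc]
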